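/- Let $G$ be a closed subgroup of $O(4)$ acting in the standard way on the unit sphere $S^3\subset\mathbb{R}^4$ by cohomogeneity two, i.e. the principal orbits of $G$ have codimension two in $S^3$. (An orbit $Gx$ is principal if for every $y\in S^3$ the isotropy group $G_x$ is contained in a conjugate of $G_y$.) Give $S^3$ its round metric $d(x,y)=\arccos\langle x,y\rangle$ and the orbit space $S^3/G$ the quotient metric $d(Gx,Gy)=\inf_{g,h\in G}d(gx,hy)$. Then $$\operatorname{diam}(S^3/G)\;\ge\;\frac{\alpha}{2},\qquad\text{where }\ \alpha=\arccos\left(\frac{\tan(3\pi/10)}{\sqrt3}\right).$$ -/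

import Mathlib

open scoped ContDiff Real

/-- The orthogonal group `O(4)`, with the topology of a set of real matrices. -/
abbrev O4 : Type := Matrix.orthogonalGroup (Fin 4) ℝ

/-- Euclidean four-space. -/
abbrev E4 : Type := EuclideanSpace ℝ (Fin 4)

/-- The unit three-sphere. -/
abbrev S3 : Type := Metric.sphere (0 : E4) 1

/-- Orthogonal matrices preserve the Euclidean norm. -/
theorem O4.norm_mulVec (A : O4) (x : E4) :
    ‖Matrix.toEuclideanLin (A : Matrix (Fin 4) (Fin 4) ℝ) x‖ = ‖x‖ := by
  have h1 : (A : Matrix (Fin 4) (Fin 4) ℝ).transpose * (A : Matrix (Fin 4) (Fin 4) ℝ) = 1 :=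
    (Matrix.mem_orthogonalGroup_iff' (Fin 4) ℝ).1 A.2
  have key : ‖Matrix.toEuclideanLin (A : Matrix (Fin 4) (Fin 4) ℝ) x‖ ^ 2 = ‖x‖ ^ 2 := by
    rw [← real_inner_self_eq_norm_sq, ← real_inner_self_eq_norm_sq]
    simp only [EuclideanSpace.inner_eq_star_dotProduct, Matrix.ofLp_toLpLin, Matrix.toLin'_apply,
      star_trivial]
    rw [Matrix.dotProduct_mulVec, ← Matrix.mulVec_transpose, Matrix.mulVec_mulVec, h1,
      Matrix.one_mulVec]
  exact (sq_eq_sq₀ (norm_nonneg _) (norm_nonneg _)).1 key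

/-- The standard action of `O(4)` on the unit sphere of `ℝ⁴`, by `(A, x) ↦ A x`. Every subgroup
of `O(4)` acts by restriction. -/
noncomputable instance O4.sphereAction : MulAction O4 S3 where
  smul A x := ⟨Matrix.toEuclideanLin (A : Matrix (Fin 4) (Fin 4) ℝ) x.1, by
    rw [mem_sphere_zero_iff_norm, O4.norm_mulVec]
    exact mem_sphere_zero_iff_norm.1 x.2⟩
  one_smul x := by
    apply Subtype.ext
    change Matrix.toEuclideanLin (1 : Matrix (Fin 4) (Fin 4) ℝ) x.1 = x.1
    simp
  mul_smul A B x := by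
    apply Subtype.ext
    change Matrix.toEuclideanLin
        ((A : Matrix (Fin 4) (Fin 4) ℝ) * (B : Matrix (Fin 4) (Fin 4) ℝ)) x.1 =
      Matrix.toEuclideanLin (A : Matrix (Fin 4) (Fin 4) ℝ)
        (Matrix.toEuclideanLin (B : Matrix (Fin 4) (Fin 4) ℝ) x.1)
    ext i
    simp [Matrix.mulVec_mulVec]

theorem O4.coe_smul (A : O4) (x : S3) :
    ((A • x : S3) : E4) = Matrix.toEuclideanLin (A : Matrix (Fin 4) (Fin 4) ℝ) (x : E4) := rfl

/-- `M` is an embedded smooth `d`-dimensional submanifold of the vector space `E`: around each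
of its points, some smooth local diffeomorphism `φ` of `E` flattens `M` onto a `d`-dimensional
linear subspace. -/
def IsSubmanifoldOfDim {E : Type*} [NormedAddCommGroup E] [NormedSpace ℝ E]
    (d : ℕ) (M : Set E) : Prop :=
  ∀ p ∈ M, ∃ (φ : OpenPartialHomeomorph E E) (V : Submodule ℝ E),
    p ∈ φ.source ∧ ContDiffOn ℝ ∞ φ φ.source ∧ ContDiffOn ℝ ∞ φ.symm φ.target ∧
    Module.finrank ℝ V = d ∧
    ∀ x ∈ φ.source, x ∈ M ↔ φ x ∈ V

/-- The orbit of `x` is a principal orbit: up to conjugation, the isotropy group of `x` is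
contained in the isotropy group of every point.  (The isotropy group of `g • y` is the conjugate
by `g` of that of `y`.) -/
def IsPrincipalPoint (G : Type*) {X : Type*} [Group G] [MulAction G X] (x : X) : Prop :=
  ∀ y : X, ∃ g : G, MulAction.stabilizer G x ≤ MulAction.stabilizer G (g • y)

/-- A subgroup of `O(4)` acts on the three-sphere by cohomogeneity `k`: its principal orbits have
codimension `k` in the sphere. -/
def ActsByCohomogeneity (G : Subgroup O4) (k : ℕ) : Prop :=
  ∃ x : S3, IsPrincipalPoint G x ∧
    ∃ d : ℕ, d + k = 3 ∧
      IsSubmanifoldOfDim d ((fun y : S3 => (y : E4)) '' MulAction.orbit G x)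

/-- The distance on `S³` induced by the round metric of curvature one: the angle between unit
vectors. -/
noncomputable def sphereDist (x y : S3) : ℝ := InnerProductGeometry.angle (x : E4) (y : E4)

/-- The quotient distance on the orbit space `S³ / G`: the infimum of the distances between
points of the two orbits. -/
noncomputable def orbitDist (G : Subgroup O4) (p q : MulAction.orbitRel.Quotient G S3) : ℝ :=
  sInf {r : ℝ | ∃ x ∈ p.orbit, ∃ y ∈ q.orbit, r = sphereDist x y}

theorem orbitDist_mem_Icc (G : Subgroup O4) (p q : MulAction.orbitRel.Quotient G S3) :
    orbitDist G p q ∈ Set.Icc 0 π := by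
  obtain ⟨x, hx⟩ := p.nonempty_orbit
  obtain ⟨y, hy⟩ := q.nonempty_orbit
  have h0 : ∀ r ∈ {r : ℝ | ∃ x ∈ p.orbit, ∃ y ∈ q.orbit, r = sphereDist x y}, 0 ≤ r := by
    rintro r ⟨x, -, y, -, rfl⟩
    exact InnerProductGeometry.angle_nonneg _ _
  exact ⟨Real.sInf_nonneg h0,
    (csInf_le ⟨0, h0⟩ ⟨x, hx, y, hy, rfl⟩).trans (InnerProductGeometry.angle_le_pi _ _)⟩

/-- The diameter of the orbit space `S³ / G`. -/
noncomputable def orbitDiam (G : Subgroup O4) : ℝ :=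
  sSup (Set.range fun pq : MulAction.orbitRel.Quotient G S3 × MulAction.orbitRel.Quotient G S3 =>
    orbitDist G pq.1 pq.2)

/-- The supremum defining the diameter is that of a bounded set. -/
theorem bddAbove_orbitDist (G : Subgroup O4) :
    BddAbove (Set.range fun pq :
      MulAction.orbitRel.Quotient G S3 × MulAction.orbitRel.Quotient G S3 =>
        orbitDist G pq.1 pq.2) := by
  refine ⟨π, ?_⟩
  rintro _ ⟨pq, rfl⟩
  exact (orbitDist_mem_Icc G pq.1 pq.2).2

/-! The principal orbits are curves and no orbit has larger dimension, so the Lie algebra of `G` is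
spanned by one skew operator `X` (`exists_lie_generator`). Conjugation by `G` sends `X` to `X` or
`-X`, hence `X²` commutes with `G` (`exists_orthogonal_or_isHopf`). If `X²` is not scalar, an
eigenspace and its orthogonal complement are invariant, and two orbits lie at distance `π/2`.
Otherwise a multiple of `X` is a complex structure `J`, and the identity component is the Hopf
circle.

In the Hopf case, identify `ℝ⁴` with the quaternions so that `J` is left multiplication by `i`. Each
element of `G` is `x ↦ u x q` with `ū i u = ±i`. The Hopf map `x ↦ x̄ i x` onto `S²` doubles the
distance between circles and turns this element into `a ↦ ±q̄ a q`. It therefore suffices to find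
`a`, `b` in `S²` such that every image of `a` makes an angle at least `α` with both `b` and `-b`.

The right multiplications in `G` form a group `Q` with isolated identity, normalized by every `q`
above. If `Q` is contained in `{1, -1}`, the images of `i` lie on at most two lines, and `b` is
taken orthogonal to both. Otherwise let `a` be the axis of a rotation of minimal angle in `Q`. Its
images are again such axes, and minimality keeps distinct axes apart (`axes_separated`). A deep hole
`b` is then the midpoint of two axes, or the centre of a triangle of axes in the icosahedral case,
the only one where the bound `cos² α = icosahedralConst` is attained (`exists_deep_hole_axes`). -/

open Filter Topology

/-! ### One-parameter subgroups and the Lie algebra of a closed group. -/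

section OneParameter

variable {A : Type*} [NormedRing A] [NormedAlgebra ℝ A] [CompleteSpace A]

-- Telescoping. Only `a` is assumed to be a contraction: in the application `b = exp (ε Z)`, whose
-- powers are merely bounded on a compact time interval.
omit [NormedAlgebra ℝ A] [CompleteSpace A] in
theorem norm_pow_sub_pow_le_of_bound {a b : A} {C : ℝ} (ha : ‖a‖ ≤ 1) (k : ℕ)
    (hb : ∀ j ≤ k, ‖b ^ j‖ ≤ C) : ‖a ^ k - b ^ k‖ ≤ k * (‖a - b‖ * C) := by
  induction k with
  | zero => simp
  | succ k ih =>
    have h1 : a ^ (k + 1) - b ^ (k + 1) = a * (a ^ k - b ^ k) + (a - b) * b ^ k := by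
      rw [pow_succ', pow_succ']; noncomm_ring
    have h2 := ih fun j hj => hb j (hj.trans k.le_succ)
    rw [h1]
    calc ‖a * (a ^ k - b ^ k) + (a - b) * b ^ k‖
        ≤ ‖a‖ * ‖a ^ k - b ^ k‖ + ‖a - b‖ * ‖b ^ k‖ :=
          (norm_add_le _ _).trans (add_le_add (norm_mul_le _ _) (norm_mul_le _ _))
      _ ≤ 1 * (k * (‖a - b‖ * C)) + ‖a - b‖ * C := by
          gcongr
          exact hb k k.le_succ
      _ = ((k + 1 : ℕ) : ℝ) * (‖a - b‖ * C) := by push_cast; ring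

theorem continuous_exp_smul (Z : A) : Continuous fun t : ℝ => NormedSpace.exp (t • Z) :=
  continuous_iff_continuousAt.2 fun t => (hasDerivAt_exp_smul_const Z t).continuousAt

theorem exp_smul_pow (Z : A) (t : ℝ) (k : ℕ) :
    NormedSpace.exp (t • Z) ^ k = NormedSpace.exp ((k * t) • Z) := by
  let : NormedAlgebra ℚ A := .restrictScalars ℚ ℝ A
  rw [← NormedSpace.exp_nsmul, mul_smul, Nat.cast_smul_eq_nsmul]

theorem exp_smul_mul_exp_neg (Z : A) (t : ℝ) :
    NormedSpace.exp (t • Z) * NormedSpace.exp ((-t) • Z) = 1 := by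
  let : NormedAlgebra ℚ A := .restrictScalars ℚ ℝ A
  rw [← NormedSpace.exp_add_of_commute, ← add_smul, add_neg_cancel, zero_smul,
    NormedSpace.exp_zero]
  exact ((Commute.refl Z).smul_left _).smul_right _

theorem tendsto_exp_smul_slope (Z : A) {ε : ℕ → ℝ} (hε : ∀ n, 0 < ε n)
    (hε0 : Tendsto ε atTop (𝓝 0)) :
    Tendsto (fun n => (ε n)⁻¹ • (NormedSpace.exp (ε n • Z) - 1)) atTop (𝓝 Z) := by
  have h := (hasDerivAt_exp_smul_const Z (0 : ℝ)).tendsto_slope_zero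
  have h2 : Tendsto ε atTop (𝓝[≠] 0) :=
    tendsto_nhdsWithin_iff.2 ⟨hε0, Eventually.of_forall fun n => (hε n).ne'⟩
  simpa [Function.comp_def] using h.comp h2

/-- A closed monoid of contractions contains the positive half of the one-parameter group
generated by any of its tangent vectors at the identity. -/
theorem exp_smul_mem_of_tendsto_slope {S : Submonoid A} (hcl : IsClosed (S : Set A))
    (hn : ∀ g ∈ S, ‖g‖ ≤ 1) {u : ℕ → A} (hu : ∀ n, u n ∈ S) {ε : ℕ → ℝ} (hε : ∀ n, 0 < ε n)
    (hε0 : Tendsto ε atTop (𝓝 0)) {Z : A}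
    (hZ : Tendsto (fun n => (ε n)⁻¹ • (u n - 1)) atTop (𝓝 Z)) {t : ℝ} (ht : 0 ≤ t) :
    NormedSpace.exp (t • Z) ∈ S := by
  obtain ⟨C, hC⟩ := (isCompact_Icc (a := (0 : ℝ)) (b := t)).exists_bound_of_continuousOn
    (continuous_exp_smul Z).continuousOn
  -- With `k n * ε n → t`, the powers `u n ^ k n` shadow `exp (k n * ε n • Z)`, which tends to `exp
  -- (t • Z)`.
  set k : ℕ → ℕ := fun n => ⌊t / ε n⌋₊ with hk
  have hk1 : ∀ n, k n * ε n ≤ t := fun n => by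
    have := Nat.floor_le (div_nonneg ht (hε n).le)
    rwa [le_div_iff₀ (hε n)] at this
  have hk2 : ∀ n, t - ε n ≤ k n * ε n := fun n => by
    have := (Nat.lt_floor_add_one (t / ε n)).le
    rw [div_le_iff₀ (hε n)] at this
    simp only [hk]
    linarith
  have hkt : Tendsto (fun n => k n * ε n) atTop (𝓝 t) :=
    tendsto_of_tendsto_of_tendsto_of_le_of_le (by simpa using tendsto_const_nhds.sub hε0)
      tendsto_const_nhds hk2 hk1
  have hexp : Tendsto (fun n => NormedSpace.exp ((k n * ε n) • Z)) atTop
      (𝓝 (NormedSpace.exp (t • Z))) := ((continuous_exp_smul Z).tendsto t).comp hkt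
  have hdiff : Tendsto (fun n => u n ^ k n - NormedSpace.exp ((k n * ε n) • Z)) atTop (𝓝 0) := by
    -- The error is `k n * ε n`, which stays bounded, times the difference of two slopes that both
    -- tend to `Z`.
    have hb : ∀ n, ‖u n ^ k n - NormedSpace.exp ((k n * ε n) • Z)‖ ≤ (k n * ε n) *
        (‖(ε n)⁻¹ • (u n - 1) - (ε n)⁻¹ • (NormedSpace.exp (ε n • Z) - 1)‖ * C) := fun n => by
      rw [← exp_smul_pow]
      refine (norm_pow_sub_pow_le_of_bound (hn _ (hu n)) (k n) (C := C) ?_).trans_eq ?_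
      · intro j hj
        rw [exp_smul_pow]
        refine hC _ ⟨mul_nonneg (Nat.cast_nonneg _) (hε n).le, le_trans ?_ (hk1 n)⟩
        exact mul_le_mul_of_nonneg_right (Nat.cast_le.2 hj) (hε n).le
      · rw [← smul_sub, norm_smul, norm_inv, Real.norm_of_nonneg (hε n).le, sub_sub_sub_cancel_right]
        have := (hε n).ne'
        field_simp
    refine squeeze_zero_norm hb ?_
    have h := (hZ.sub (tendsto_exp_smul_slope Z hε hε0)).norm
    simpa using hkt.mul (h.mul_const C)
  refine hcl.mem_of_tendsto (b := atTop) (f := fun n => u n ^ k n) ?_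
    (Eventually.of_forall fun n => S.pow_mem (hu n) _)
  simpa using hdiff.add hexp

theorem exp_smul_mem_of_tendsto_slope' {S : Submonoid A} (hcl : IsClosed (S : Set A))
    (hn : ∀ g ∈ S, ‖g‖ ≤ 1) (hinv : ∀ g ∈ S, ∃ h ∈ S, h * g = 1)
    {u : ℕ → A} (hu : ∀ n, u n ∈ S) {ε : ℕ → ℝ} (hε : ∀ n, 0 < ε n)
    (hε0 : Tendsto ε atTop (𝓝 0)) {Z : A}
    (hZ : Tendsto (fun n => (ε n)⁻¹ • (u n - 1)) atTop (𝓝 Z)) (t : ℝ) :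
    NormedSpace.exp (t • Z) ∈ S := by
  rcases le_total 0 t with ht | ht
  · exact exp_smul_mem_of_tendsto_slope hcl hn hu hε hε0 hZ ht
  · obtain ⟨h, hh, h1⟩ := hinv _
      (exp_smul_mem_of_tendsto_slope hcl hn hu hε hε0 hZ (neg_nonneg.2 ht))
    have h2 := exp_smul_mul_exp_neg Z (-t)
    rw [neg_neg] at h2
    rwa [← left_inv_eq_right_inv h1 h2]

/-- The Lie algebra of a closed group of contractions. -/
def lieAlg (S : Submonoid A) (hcl : IsClosed (S : Set A))
    (hn : ∀ g ∈ S, ‖g‖ ≤ 1) (hinv : ∀ g ∈ S, ∃ h ∈ S, h * g = 1) : Submodule ℝ A where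
  carrier := {Z | ∀ t : ℝ, NormedSpace.exp (t • Z) ∈ S}
  zero_mem' t := by simp [NormedSpace.exp_zero, S.one_mem]
  smul_mem' c Z hZ t := by rw [smul_smul]; exact hZ _
  add_mem' {Z W} hZ hW t := by
    have hε : ∀ n : ℕ, (0 : ℝ) < 1 / ((n : ℝ) + 1) := fun n => Nat.one_div_pos_of_nat
    have hε0 := tendsto_one_div_add_atTop_nhds_zero_nat (𝕜 := ℝ)
    -- The curve `exp (s Z) exp (s W)` stays in `S` and has velocity `Z + W` at `s = 0`.
    refine exp_smul_mem_of_tendsto_slope' hcl hn hinv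
      (u := fun n => NormedSpace.exp ((1 / ((n : ℝ) + 1)) • Z) *
        NormedSpace.exp ((1 / ((n : ℝ) + 1)) • W))
      (fun n => S.mul_mem (hZ _) (hW _)) hε hε0 ?_ t
    have h1 : HasDerivAt (fun s : ℝ => NormedSpace.exp (s • Z) * NormedSpace.exp (s • W))
        (Z + W) 0 := by
      simpa [NormedSpace.exp_zero] using
        (hasDerivAt_exp_smul_const Z (0 : ℝ)).fun_mul (hasDerivAt_exp_smul_const W (0 : ℝ))
    have h2 : Tendsto (fun n : ℕ => 1 / ((n : ℝ) + 1)) atTop (𝓝[≠] 0) :=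
      tendsto_nhdsWithin_iff.2 ⟨hε0, Eventually.of_forall fun n => (hε n).ne'⟩
    simpa [Function.comp_def, NormedSpace.exp_zero] using h1.tendsto_slope_zero.comp h2

/-- The normalized differences `(u n - 1) / ‖u n - 1‖` subconverge to a unit vector by compactness,
and the closed subspace `W` keeps the limit. Taking `W = ⊤` shows that the Lie algebra is nonzero; a
smaller `W` serves to prove discreteness. -/
theorem exists_mem_lieAlg_of_tendsto [FiniteDimensional ℝ A] {S : Submonoid A}
    (hcl : IsClosed (S : Set A)) (hn : ∀ g ∈ S, ‖g‖ ≤ 1) (hinv : ∀ g ∈ S, ∃ h ∈ S, h * g = 1)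
    {u : ℕ → A} (hu : ∀ n, u n ∈ S) (hu1 : ∀ n, u n ≠ 1) (hlim : Tendsto u atTop (𝓝 1))
    (W : Submodule ℝ A) (hW : ∀ n, u n - 1 ∈ W) :
    ∃ Z ∈ lieAlg S hcl hn hinv, Z ≠ 0 ∧ Z ∈ W := by
  have : ProperSpace A := FiniteDimensional.proper ℝ A
  set ε : ℕ → ℝ := fun n => ‖u n - 1‖ with hεd
  have hε : ∀ n, 0 < ε n := fun n => norm_pos_iff.2 (sub_ne_zero.2 (hu1 n))
  have hε0 : Tendsto ε atTop (𝓝 0) := by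
    simpa using (hlim.sub_const 1).norm
  have hsph : ∀ n, (ε n)⁻¹ • (u n - 1) ∈ Metric.sphere (0 : A) 1 := fun n => by
    rw [mem_sphere_zero_iff_norm, norm_smul, norm_inv, norm_norm, inv_mul_cancel₀ (hε n).ne']
  obtain ⟨Z, hZ, φ, hφ, hφt⟩ := (isCompact_sphere (0 : A) 1).tendsto_subseq hsph
  refine ⟨Z, fun t => ?_, ?_, ?_⟩
  · exact exp_smul_mem_of_tendsto_slope' hcl hn hinv (fun n => hu (φ n)) (fun n => hε (φ n))
      (hε0.comp hφ.tendsto_atTop) hφt t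
  · rintro rfl
    simp at hZ
  · exact W.closed_of_finiteDimensional.mem_of_tendsto hφt
      (Eventually.of_forall fun n => W.smul_mem _ (hW _))

end OneParameter

/-! ### Closed groups of linear isometries with one-dimensional principal orbits. -/

section OrthogonalGroups

variable {E : Type*} [NormedAddCommGroup E] [InnerProductSpace ℝ E] [FiniteDimensional ℝ E]

/-- A closed group of linear isometries of a Euclidean space. -/
structure IsClosedOrthogonal (S : Submonoid (E →L[ℝ] E)) : Prop where
  isClosed : IsClosed (S : Set (E →L[ℝ] E))
  norm_apply : ∀ g ∈ S, ∀ x, ‖g x‖ = ‖x‖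
  exists_inv : ∀ g ∈ S, ∃ h ∈ S, h * g = 1 ∧ g * h = 1

namespace IsClosedOrthogonal

variable [CompleteSpace E] {S : Submonoid (E →L[ℝ] E)} (hS : IsClosedOrthogonal S)
include hS

omit [FiniteDimensional ℝ E] [CompleteSpace E] in
theorem norm_le_one (g : E →L[ℝ] E) (hg : g ∈ S) : ‖g‖ ≤ 1 :=
  g.opNorm_le_bound zero_le_one fun x => by rw [hS.norm_apply g hg, one_mul]

omit [FiniteDimensional ℝ E] [CompleteSpace E] in
theorem exists_left_inv (g : E →L[ℝ] E) (hg : g ∈ S) : ∃ h ∈ S, h * g = 1 :=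
  let ⟨h, hh, h1, _⟩ := hS.exists_inv g hg
  ⟨h, hh, h1⟩

omit [FiniteDimensional ℝ E] [CompleteSpace E] in
theorem inner_apply {g : E →L[ℝ] E} (hg : g ∈ S) (x y : E) :
    inner ℝ (g x) (g y) = inner ℝ x y := by
  rw [real_inner_eq_norm_add_mul_self_sub_norm_mul_self_sub_norm_mul_self_div_two,
    real_inner_eq_norm_add_mul_self_sub_norm_mul_self_sub_norm_mul_self_div_two,
    ← map_add, hS.norm_apply g hg, hS.norm_apply g hg, hS.norm_apply g hg]

/-- The Lie algebra of a closed group of linear isometries. -/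
noncomputable def lie : Submodule ℝ (E →L[ℝ] E) :=
  lieAlg S hS.isClosed hS.norm_le_one hS.exists_left_inv

theorem exp_mem {Z : E →L[ℝ] E} (hZ : Z ∈ hS.lie) (t : ℝ) :
    NormedSpace.exp (t • Z) ∈ S := hZ t

omit hS [FiniteDimensional ℝ E] in
theorem hasDerivAt_exp_apply (Z : E →L[ℝ] E) (x : E) (t : ℝ) :
    HasDerivAt (fun s : ℝ => NormedSpace.exp (s • Z) x) (NormedSpace.exp (t • Z) (Z x)) t := by
  simpa using (hasDerivAt_exp_smul_const Z t).clm_apply (hasDerivAt_const t x)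

omit hS in
theorem hasDerivAt_exp_apply_zero (Z : E →L[ℝ] E) (x : E) :
    HasDerivAt (fun s : ℝ => NormedSpace.exp (s • Z) x) (Z x) 0 := by
  simpa [NormedSpace.exp_zero] using hasDerivAt_exp_apply Z x 0

omit hS in
theorem exp_apply_eq_self {Z : E →L[ℝ] E} {x : E} (hx : Z x = 0) (t : ℝ) :
    NormedSpace.exp (t • Z) x = x := by
  have h := is_const_of_deriv_eq_zero (f := fun s : ℝ => NormedSpace.exp (s • Z) x)
    (fun s => (hasDerivAt_exp_apply Z x s).differentiableAt)
    (fun s => by rw [(hasDerivAt_exp_apply Z x s).deriv, hx, map_zero]) t 0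
  simpa [NormedSpace.exp_zero] using h

omit hS in
theorem apply_eq_zero_of_exp {Z : E →L[ℝ] E} {x : E}
    (hx : ∀ t : ℝ, NormedSpace.exp (t • Z) x = x) : Z x = 0 := by
  have h := hasDerivAt_exp_apply_zero Z x
  simp only [hx] at h
  exact h.unique (hasDerivAt_const _ _)

theorem inner_apply_self {Z : E →L[ℝ] E} (hZ : Z ∈ hS.lie) (x : E) :
    inner ℝ (Z x) x = 0 := by
  have h := (hasDerivAt_exp_apply_zero Z x).inner ℝ (hasDerivAt_exp_apply_zero Z x)
  simp only [hS.inner_apply (hS.exp_mem hZ _), zero_smul, NormedSpace.exp_zero,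
    one_apply_eq_self] at h
  have h1 := h.unique (hasDerivAt_const _ _)
  rw [real_inner_comm] at h1
  linarith

theorem inner_skew {Z : E →L[ℝ] E} (hZ : Z ∈ hS.lie) (x y : E) :
    inner ℝ (Z x) y = -inner ℝ x (Z y) := by
  have h := hS.inner_apply_self hZ (x + y)
  rw [map_add, inner_add_left, inner_add_right, inner_add_right, hS.inner_apply_self hZ,
    hS.inner_apply_self hZ, real_inner_comm (Z y) x] at *
  linarith

theorem conj_mem {Z g h : E →L[ℝ] E} (hZ : Z ∈ hS.lie) (hg : g ∈ S) (hh : h ∈ S)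
    (h1 : h * g = 1) (h2 : g * h = 1) : g * Z * h ∈ hS.lie := by
  intro t
  let : NormedAlgebra ℚ (E →L[ℝ] E) := .restrictScalars ℚ ℝ _
  have hs : SemiconjBy g (t • Z) (t • (g * Z * h)) := by
    rw [SemiconjBy, smul_mul_assoc, mul_assoc (g * Z), h1, mul_one, mul_smul_comm]
  have he := hs.exp_right
  have : NormedSpace.exp (t • (g * Z * h)) = g * NormedSpace.exp (t • Z) * h := by
    rw [he.eq, mul_assoc _ g h, h2, mul_one]
  rw [this]
  exact S.mul_mem (S.mul_mem hg (hS.exp_mem hZ t)) hh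

/-- Evaluation of the Lie algebra at a point; its range is the tangent space of the orbit. -/
noncomputable def evalLie (x : E) : hS.lie →ₗ[ℝ] E where
  toFun Z := Z.1 x
  map_add' _ _ := rfl
  map_smul' _ _ := rfl

/-- The differential of a flattening chart is injective and sends the velocity of each curve `exp (t
Z) x` in the orbit into `V`. -/
theorem finrank_range_evalLie_le {x : E} {d : ℕ}
    (hM : IsSubmanifoldOfDim d {y | ∃ g ∈ S, y = g x}) :
    Module.finrank ℝ (LinearMap.range (hS.evalLie x)) ≤ d := by
  obtain ⟨φ, V, hx, hφ, hφs, hV, hiff⟩ := hM x ⟨1, S.one_mem, rfl⟩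
  have hd : DifferentiableAt ℝ φ x :=
    (hφ.contDiffAt (φ.open_source.mem_nhds hx)).differentiableAt (by simp)
  have hds : DifferentiableAt ℝ φ.symm (φ x) :=
    (hφs.contDiffAt (φ.open_target.mem_nhds (φ.map_source hx))).differentiableAt (by simp)
  have hinj : Function.Injective (fderiv ℝ φ x) := by
    have hc := hds.hasFDerivAt.comp x hd.hasFDerivAt
    have hid : HasFDerivAt (φ.symm ∘ φ) (ContinuousLinearMap.id ℝ E) x :=
      (hasFDerivAt_id x).congr_of_eventuallyEq (φ.eventually_left_inverse hx)
    have he := hc.unique hid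
    intro v w hvw
    have h1 := DFunLike.congr_fun he v
    have h2 := DFunLike.congr_fun he w
    simp only [ContinuousLinearMap.comp_apply, ContinuousLinearMap.id_apply] at h1 h2
    rw [← h1, ← h2, hvw]
  have hmem : ∀ Z ∈ hS.lie, fderiv ℝ φ x (Z x) ∈ V := by
    intro Z hZ
    have h0 := hasDerivAt_exp_apply_zero Z x
    have hd' : HasFDerivAt φ (fderiv ℝ φ x) (NormedSpace.exp ((0 : ℝ) • Z) x) := by
      simpa [NormedSpace.exp_zero] using hd.hasFDerivAt
    have h1 := hd'.comp_hasDerivAt (0 : ℝ) h0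
    have h2 := h1.tendsto_slope_zero
    have hev : ∀ᶠ t : ℝ in 𝓝 0, NormedSpace.exp (t • Z) x ∈ φ.source :=
      h0.continuousAt.eventually (φ.open_source.mem_nhds (by simpa [NormedSpace.exp_zero] using hx))
    refine V.closed_of_finiteDimensional.mem_of_tendsto h2 ?_
    filter_upwards [hev.filter_mono nhdsWithin_le_nhds] with t ht
    refine V.smul_mem _ (V.sub_mem ?_ ?_)
    · simp only [Function.comp_apply, zero_add]
      exact (hiff _ ht).1 ⟨_, hS.exp_mem hZ t, rfl⟩
    · simp only [Function.comp_apply, zero_smul, NormedSpace.exp_zero,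
        one_apply_eq_self]
      exact (hiff _ hx).1 ⟨1, S.one_mem, rfl⟩
  rw [← hV, ← LinearMap.finrank_range_of_inj (f := (fderiv ℝ φ x).toLinearMap.comp
    (LinearMap.range (hS.evalLie x)).subtype) (hinj.comp Subtype.val_injective)]
  refine Submodule.finrank_mono ?_
  rintro _ ⟨⟨_, ⟨Z, rfl⟩⟩, rfl⟩
  exact hmem Z.1 Z.2

/-- Orbits have dimension at most that of the principal ones. -/
theorem finrank_range_evalLie_le_of_principal {x y : E}
    (hxy : ∃ g ∈ S, ∀ h ∈ S, h x = x → h (g y) = g y) :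
    Module.finrank ℝ (LinearMap.range (hS.evalLie y)) ≤
      Module.finrank ℝ (LinearMap.range (hS.evalLie x)) := by
  obtain ⟨g, hg, hst⟩ := hxy
  obtain ⟨h, hh, h1, h2⟩ := hS.exists_inv g hg
  have hx := (hS.evalLie x).finrank_range_add_finrank_ker
  have hy := (hS.evalLie y).finrank_range_add_finrank_ker
  have hker : Module.finrank ℝ (LinearMap.ker (hS.evalLie x)) ≤
      Module.finrank ℝ (LinearMap.ker (hS.evalLie y)) := by
    -- The kernel of evaluation at `x` generates rotations fixing `x`, hence fixing `g y`;
    -- conjugating by the inverse of `g` gives operators that kill `y`.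
    let f : LinearMap.ker (hS.evalLie x) →ₗ[ℝ] LinearMap.ker (hS.evalLie y) :=
      { toFun := fun Z => ⟨⟨h * Z.1.1 * g, hS.conj_mem Z.1.2 hh hg h2 h1⟩, by
          have hz : Z.1.1 (g y) = 0 :=
            apply_eq_zero_of_exp fun t => hst _ (hS.exp_mem Z.1.2 t)
              (exp_apply_eq_self Z.2 t)
          change h (Z.1.1 (g y)) = 0
          rw [hz, map_zero]⟩
        map_add' := fun Z W => by
          ext1; ext1
          change h * (Z.1.1 + W.1.1) * g = h * Z.1.1 * g + h * W.1.1 * g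
          rw [mul_add, add_mul]
        map_smul' := fun c Z => by
          ext1; ext1
          change h * (c • Z.1.1) * g = c • (h * Z.1.1 * g)
          rw [mul_smul_comm, smul_mul_assoc] }
    refine LinearMap.finrank_le_finrank_of_injective (f := f) fun Z W hZW => ?_
    have e : h * Z.1.1 * g = h * W.1.1 * g := congrArg (fun q => q.1.1) hZW
    have e2 : g * (h * Z.1.1 * g) * h = g * (h * W.1.1 * g) * h := by rw [e]
    have e3 : ∀ T : E →L[ℝ] E, g * (h * T * g) * h = T := fun T => by
      rw [mul_assoc h, ← mul_assoc g h, h2, one_mul, mul_assoc, h2, mul_one]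
    rw [e3, e3] at e2
    exact Subtype.ext (Subtype.ext e2)
  omega

end IsClosedOrthogonal

-- After subtracting a multiple of `X`, the operator `Y` kills some `v` with `X v ≠ 0`. Comparing
-- the dependences at `w` and `v + w` confines its image to the line of `X v`, and a skew operator
-- of rank at most one vanishes.
omit [FiniteDimensional ℝ E] in
theorem exists_smul_eq_of_skew_of_pointwise_dependent {X Y : E →L[ℝ] E} (hX0 : X ≠ 0)
    (hX : ∀ x y, inner ℝ (X x) y = -inner ℝ x (X y))
    (hY : ∀ x y, inner ℝ (Y x) y = -inner ℝ x (Y y))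
    (hdep : ∀ y, ∃ a b : ℝ, (a ≠ 0 ∨ b ≠ 0) ∧ a • X y + b • Y y = 0) :
    ∃ c : ℝ, Y = c • X := by
  obtain ⟨v, hv⟩ : ∃ v, X v ≠ 0 := by
    by_contra! h
    exact hX0 (ContinuousLinearMap.ext h)
  have hpar : ∀ y, X y ≠ 0 → ∃ c : ℝ, Y y = c • X y := fun y hy => by
    obtain ⟨a, b, hab, h⟩ := hdep y
    have hb : b ≠ 0 := by
      rintro rfl
      simp_all
    refine ⟨-a / b, ?_⟩
    have : Y y = b⁻¹ • (b • Y y) := by rw [smul_smul, inv_mul_cancel₀ hb, one_smul]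
    rw [this, eq_neg_of_add_eq_zero_right h, ← neg_smul, smul_smul]
    congr 1
    field_simp
  obtain ⟨c, hc⟩ := hpar v hv
  refine ⟨c, ?_⟩
  -- `Z = Y - c X` kills `v`, and `Z w` is a multiple of `X v` for every `w`
  set Z := Y - c • X with hZd
  have hZ : ∀ x y, inner ℝ (Z x) y = -inner ℝ x (Z y) := fun x y => by
    simp only [hZd, sub_apply, smul_apply, inner_sub_left,
      inner_sub_right, hX x y, hY x y, inner_smul_left, inner_smul_right, conj_trivial]
    ring
  have hZdep : ∀ y, ∃ a b : ℝ, (a ≠ 0 ∨ b ≠ 0) ∧ a • X y + b • Z y = 0 := fun y => by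
    obtain ⟨a, b, hab, h⟩ := hdep y
    refine ⟨a + b * c, b, ?_, ?_⟩
    · by_contra! h'
      obtain ⟨h1, rfl⟩ := h'
      simp_all
    · rw [← h]
      simp only [hZd, sub_apply, smul_apply]
      module
  have hZv : Z v = 0 := by simp [hZd, hc]
  have hrange : ∀ w, ∃ f : ℝ, Z w = f • X v := fun w => by
    by_cases hw : Z w = 0
    · exact ⟨0, by simp [hw]⟩
    obtain ⟨a, b, hab, h⟩ := hZdep w
    obtain ⟨a', b', hab', h'⟩ := hZdep (v + w)
    have ha : a ≠ 0 := by
      rintro rfl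
      simp_all
    have ha' : a' ≠ 0 := by
      rintro rfl
      simp_all
    have hXw : X w = (-(b / a)) • Z w := by
      have : X w = a⁻¹ • (a • X w) := by rw [smul_smul, inv_mul_cancel₀ ha, one_smul]
      rw [this, eq_neg_of_add_eq_zero_left h, ← neg_smul, smul_smul]
      congr 1
      field_simp
    have hXvw : X v = (b / a - b' / a') • Z w := by
      have e : X (v + w) = a'⁻¹ • (a' • X (v + w)) := by
        rw [smul_smul, inv_mul_cancel₀ ha', one_smul]
      rw [eq_neg_of_add_eq_zero_left h', map_add, map_add, hZv, zero_add, hXw] at e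
      have e2 : X v = a'⁻¹ • -(b' • Z w) - (-(b / a)) • Z w := eq_sub_of_add_eq e
      rw [e2, ← neg_smul, smul_smul, ← sub_smul]
      congr 1
      field_simp
      ring
    have hne : b / a - b' / a' ≠ 0 := by
      intro h0
      rw [h0, zero_smul] at hXvw
      exact hv hXvw
    exact ⟨(b / a - b' / a')⁻¹, by rw [hXvw, smul_smul, inv_mul_cancel₀ hne, one_smul]⟩
  have hZ0 : Z = 0 := by
    have hpos : inner ℝ (X v) (X v) ≠ (0 : ℝ) := inner_self_ne_zero.2 hv
    obtain ⟨fe, hfe⟩ := hrange (X v)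
    have hfe0 : fe = 0 := by
      have h1 := hZ (X v) (X v)
      rw [hfe, inner_smul_left, inner_smul_right, conj_trivial] at h1
      have h2 : fe * inner ℝ (X v) (X v) = 0 := by linarith
      exact (mul_eq_zero.1 h2).resolve_right hpos
    refine ContinuousLinearMap.ext fun w => ?_
    obtain ⟨f, hf⟩ := hrange w
    have h1 := hZ w (X v)
    rw [hfe, hfe0, zero_smul, inner_zero_right, neg_zero, hf, inner_smul_left, conj_trivial] at h1
    rw [hf, (mul_eq_zero.1 h1).resolve_right hpos, zero_smul, zero_apply]
  exact sub_eq_zero.1 hZ0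

-- A short segment in the flattened picture pulls back to infinitely many points. This excludes
-- finite groups.
omit [FiniteDimensional ℝ E] in
theorem IsSubmanifoldOfDim.infinite {M : Set E} (hM : IsSubmanifoldOfDim 1 M)
    (hne : M.Nonempty) : M.Infinite := by
  obtain ⟨p, hp⟩ := hne
  obtain ⟨φ, V, hx, -, -, hV, hiff⟩ := hM p hp
  obtain ⟨v, hv⟩ : ∃ v : V, v ≠ 0 := by
    have : Nontrivial V := Module.nontrivial_of_finrank_pos (R := ℝ) (by omega)
    exact exists_ne 0
  have hv' : (v : E) ≠ 0 := fun h => hv (Subtype.ext h)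
  have hcont : Continuous fun t : ℝ => φ p + t • (v : E) := by fun_prop
  have hnh : {t : ℝ | φ p + t • (v : E) ∈ φ.target} ∈ 𝓝 (0 : ℝ) :=
    hcont.continuousAt.preimage_mem_nhds
      (φ.open_target.mem_nhds (by simpa using φ.map_source hx))
  refine Set.infinite_of_injOn_mapsTo (f := fun t : ℝ => φ.symm (φ p + t • (v : E))) ?_ ?_
    (infinite_of_mem_nhds (0 : ℝ) hnh)
  · intro s hs t ht hst
    have h1 := φ.symm.injOn hs ht hst
    exact smul_left_injective ℝ hv' (add_left_cancel h1)
  · intro t ht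
    refine (hiff _ (φ.map_target ht)).2 ?_
    rw [φ.right_inv ht]
    exact V.add_mem ((hiff p hx).1 hp) (V.smul_mem _ v.2)

namespace IsClosedOrthogonal

variable [CompleteSpace E] {S : Submonoid (E →L[ℝ] E)} (hS : IsClosedOrthogonal S)
include hS

/-- `S` is compact, so some sequence of distinct elements converges; the quotients of consecutive
terms then tend to `1` without reaching it. -/
theorem exists_tendsto_one (hinf : (S : Set (E →L[ℝ] E)).Infinite) :
    ∃ u : ℕ → E →L[ℝ] E, (∀ n, u n ∈ S) ∧ (∀ n, u n ≠ 1) ∧ Tendsto u atTop (𝓝 1) := by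
  have hcomp : IsCompact (S : Set (E →L[ℝ] E)) := by
    have : ProperSpace (E →L[ℝ] E) := FiniteDimensional.proper ℝ _
    refine (isCompact_closedBall (0 : E →L[ℝ] E) 1).of_isClosed_subset hS.isClosed fun g hg => ?_
    simpa using hS.norm_le_one g hg
  let f := hinf.natEmbedding
  obtain ⟨g, hg, φ, hφ, hlim⟩ := hcomp.tendsto_subseq (fun n => (f n).2)
  choose h hh h1 h2 using fun n => hS.exists_inv (f n).1 (f n).2
  refine ⟨fun n => h (φ n) * (f (φ (n + 1))).1, fun n => S.mul_mem (hh _) (f _).2, ?_, ?_⟩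
  · intro n hn
    have hn : h (φ n) * (f (φ (n + 1))).1 = 1 := hn
    have e : (f (φ n)).1 * (h (φ n) * (f (φ (n + 1))).1) = (f (φ n)).1 * 1 := by rw [hn]
    rw [← mul_assoc, h2, one_mul, mul_one] at e
    have := hφ.injective (f.injective (Subtype.ext e))
    omega
  · rw [tendsto_iff_norm_sub_tendsto_zero]
    have hd : Tendsto (fun n => ‖(f (φ (n + 1))).1 - (f (φ n)).1‖) atTop (𝓝 0) := by
      have := ((hlim.comp (tendsto_add_atTop_nat 1)).sub hlim).norm
      simpa [Function.comp_def] using this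
    refine squeeze_zero (fun n => norm_nonneg _) (fun n => ?_) hd
    have e : h (φ n) * (f (φ (n + 1))).1 - 1 = h (φ n) * ((f (φ (n + 1))).1 - (f (φ n)).1) := by
      rw [mul_sub, h1]
    rw [e]
    refine (norm_mul_le _ _).trans ?_
    exact mul_le_of_le_one_left (norm_nonneg _) (hS.norm_le_one _ (hh _))

/-- A closed group whose principal orbits are curves has a one-dimensional Lie algebra. -/
theorem exists_lie_generator {x : E} (hM : IsSubmanifoldOfDim 1 {y | ∃ g ∈ S, y = g x})
    (hpr : ∀ y : E, ‖y‖ = 1 → ∃ g ∈ S, ∀ h ∈ S, h x = x → h (g y) = g y) :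
    ∃ X ∈ hS.lie, X ≠ 0 ∧ ∀ Y ∈ hS.lie, ∃ c : ℝ, Y = c • X := by
  have hinf : (S : Set (E →L[ℝ] E)).Infinite := by
    intro hfin
    refine hM.infinite ⟨x, 1, S.one_mem, rfl⟩ ((hfin.image fun g => g x).subset ?_)
    rintro _ ⟨g, hg, rfl⟩
    exact ⟨g, hg, rfl⟩
  obtain ⟨u, hu, hu1, hlim⟩ := hS.exists_tendsto_one hinf
  obtain ⟨X, hX, hX0, -⟩ := exists_mem_lieAlg_of_tendsto hS.isClosed hS.norm_le_one
    hS.exists_left_inv hu hu1 hlim ⊤ fun n => trivial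
  refine ⟨X, hX, hX0, fun Y hY => exists_smul_eq_of_skew_of_pointwise_dependent hX0
    (hS.inner_skew hX) (hS.inner_skew hY) fun y => ?_⟩
  -- Tangent spaces of orbits have dimension at most one, so `X y` and `Y y` are dependent.
  have hunit : ∀ y : E, ‖y‖ = 1 → ∃ a b : ℝ, (a ≠ 0 ∨ b ≠ 0) ∧ a • X y + b • Y y = 0 := by
    intro y hy
    have hr := (hS.finrank_range_evalLie_le_of_principal (hpr y hy)).trans
      (hS.finrank_range_evalLie_le hM)
    by_contra! hcon
    have hli : LinearIndependent ℝ ![hS.evalLie y ⟨X, hX⟩, hS.evalLie y ⟨Y, hY⟩] := by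
      rw [LinearIndependent.pair_iff]
      intro a b hab
      by_contra hne
      exact hcon a b (by tauto) hab
    have h2 := hli.span_eq_top_of_card_eq_finrank
    have hle : Submodule.span ℝ (Set.range ![hS.evalLie y ⟨X, hX⟩, hS.evalLie y ⟨Y, hY⟩]) ≤
        LinearMap.range (hS.evalLie y) := by
      rw [Submodule.span_le]
      rintro _ ⟨i, rfl⟩
      fin_cases i
      · exact ⟨_, rfl⟩
      · exact ⟨_, rfl⟩
    have h3 := Submodule.finrank_mono hle
    rw [finrank_span_eq_card hli, Fintype.card_fin] at h3
    omega
  rcases eq_or_ne y 0 with rfl | hy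
  · exact ⟨1, 0, by simp, by simp⟩
  obtain ⟨a, b, hab, h⟩ := hunit (‖y‖⁻¹ • y) (by
    rw [norm_smul, norm_inv, norm_norm, inv_mul_cancel₀ (norm_ne_zero_iff.2 hy)])
  refine ⟨a, b, hab, ?_⟩
  rw [map_smul, map_smul, smul_comm a, smul_comm b, ← smul_add] at h
  exact (smul_eq_zero.1 h).resolve_left (inv_ne_zero (norm_ne_zero_iff.2 hy))

end IsClosedOrthogonal

end OrthogonalGroups

/-- Euler's formula: the product of `exp (t J)` with `cos t - sin t J` has zero derivative. -/
theorem exp_smul_eq_of_sq_eq_neg_one {A : Type*} [NormedRing A] [NormedAlgebra ℝ A] [CompleteSpace A]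
    {J : A} (hJ : J * J = -1) (t : ℝ) :
    NormedSpace.exp (t • J) = Real.cos t • (1 : A) + Real.sin t • J := by
  have hd : ∀ t : ℝ, HasDerivAt (fun t : ℝ => NormedSpace.exp (t • J) *
      (Real.cos t • (1 : A) - Real.sin t • J)) 0 t := fun t => by
    have h1 := (hasDerivAt_exp_smul_const J t).fun_mul
      (((Real.hasDerivAt_cos t).smul_const (1 : A)).fun_sub
        ((Real.hasDerivAt_sin t).smul_const J))
    convert h1 using 1
    rw [mul_assoc, ← mul_add, mul_sub, mul_smul_comm, mul_smul_comm, mul_one, hJ]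
    have : Real.cos t • J - Real.sin t • (-1 : A) +
        (-Real.sin t • (1 : A) - Real.cos t • J) = 0 := by module
    rw [this, mul_zero]
  have hc := is_const_of_deriv_eq_zero (fun t => (hd t).differentiableAt)
    (fun t => (hd t).deriv) t 0
  simp only [zero_smul, NormedSpace.exp_zero, Real.cos_zero, Real.sin_zero, one_smul, sub_zero,
    mul_one] at hc
  have hinv : (Real.cos t • (1 : A) - Real.sin t • J) *
      (Real.cos t • (1 : A) + Real.sin t • J) = 1 := by
    rw [sub_mul, mul_add, mul_add]
    simp only [smul_mul_assoc, mul_smul_comm, one_mul, mul_one, hJ]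
    have h2 : Real.cos t • Real.cos t • (1 : A) + Real.sin t • Real.cos t • J -
        (Real.cos t • Real.sin t • J + Real.sin t • Real.sin t • -1) =
        (Real.sin t ^ 2 + Real.cos t ^ 2) • (1 : A) := by module
    rw [Real.sin_sq_add_cos_sq, one_smul] at h2
    refine Eq.trans ?_ h2
    module
  exact left_inv_eq_right_inv hc hinv

/-! ### The dichotomy: orthogonal invariant subspaces or a complex structure. -/

section HopfStructure

variable {E : Type*} [NormedAddCommGroup E] [InnerProductSpace ℝ E] [FiniteDimensional ℝ E]

theorem exists_unit_orthogonal (hE : Module.finrank ℝ E = 4) (v₁ v₂ v₃ : E) :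
    ∃ b : E, ‖b‖ = 1 ∧ inner ℝ v₁ b = 0 ∧ inner ℝ v₂ b = 0 ∧ inner ℝ v₃ b = 0 := by
  set K := Submodule.span ℝ (Set.range ![v₁, v₂, v₃]) with hK
  have h1 : Module.finrank ℝ K ≤ 3 := by
    simpa [Set.finrank] using finrank_range_le_card (R := ℝ) ![v₁, v₂, v₃]
  have h2 := K.finrank_add_finrank_orthogonal
  have : Nontrivial Kᗮ := Module.nontrivial_of_finrank_pos (R := ℝ) (by omega)
  obtain ⟨⟨w, hw⟩, hne⟩ := exists_ne (0 : Kᗮ)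
  have hw0 : w ≠ 0 := fun h => hne (Subtype.ext h)
  have hi : ∀ i, inner ℝ (![v₁, v₂, v₃] i) w = 0 := fun i =>
    (Submodule.mem_orthogonal K w).1 hw _ (Submodule.subset_span ⟨i, rfl⟩)
  refine ⟨‖w‖⁻¹ • w, ?_, ?_, ?_, ?_⟩
  · rw [norm_smul, norm_inv, norm_norm, inv_mul_cancel₀ (norm_ne_zero_iff.2 hw0)]
  · rw [inner_smul_right, show inner ℝ v₁ w = 0 from hi 0, mul_zero]
  · rw [inner_smul_right, show inner ℝ v₂ w = 0 from hi 1, mul_zero]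
  · rw [inner_smul_right, show inner ℝ v₃ w = 0 from hi 2, mul_zero]

variable [CompleteSpace E] {S : Submonoid (E →L[ℝ] E)}

/-- The identity component of the group `S` is the circle generated by the complex
structure `J`. -/
structure IsHopf (hS : IsClosedOrthogonal S) (J : E →L[ℝ] E) : Prop where
  apply_apply : ∀ x, J (J x) = -x
  skew : ∀ x y, inner ℝ (J x) y = -inner ℝ x (J y)
  circle_mem : ∀ t : ℝ, Real.cos t • (1 : E →L[ℝ] E) + Real.sin t • J ∈ S
  comm_or : ∀ g ∈ S, (∀ x, g (J x) = J (g x)) ∨ ∀ x, g (J x) = -J (g x)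
  lie_eq : ∀ Y ∈ hS.lie, ∃ c : ℝ, Y = c • J

theorem exists_orthogonal_or_isHopf [Nontrivial E] (hS : IsClosedOrthogonal S)
    {X : E →L[ℝ] E} (hX : X ∈ hS.lie) (hX0 : X ≠ 0)
    (hgen : ∀ Y ∈ hS.lie, ∃ c : ℝ, Y = c • X) :
    (∃ u v : E, ‖u‖ = 1 ∧ ‖v‖ = 1 ∧ ∀ g ∈ S, inner ℝ (g u) v = 0) ∨ ∃ J, IsHopf hS J := by
  have hcomm : ∀ g ∈ S, g * X = X * g ∨ g * X = -(X * g) := by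
    intro g hg
    obtain ⟨h, hh, h1, h2⟩ := hS.exists_inv g hg
    obtain ⟨c, hc⟩ := hgen _ (hS.conj_mem hX hg hh h1 h2)
    have hle : ∀ g ∈ S, ∀ h ∈ S, ∀ Y : E →L[ℝ] E, ‖g * Y * h‖ ≤ ‖Y‖ := fun g hg h hh Y =>
      calc ‖g * Y * h‖ ≤ ‖g * Y‖ * ‖h‖ := norm_mul_le _ _
        _ ≤ ‖g‖ * ‖Y‖ * ‖h‖ := by gcongr; exact norm_mul_le _ _
        _ ≤ 1 * ‖Y‖ * 1 := by
          gcongr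
          · exact hS.norm_le_one g hg
          · exact hS.norm_le_one h hh
        _ = ‖Y‖ := by ring
    -- Conjugation by isometries preserves the norm, which forces `c = ±1`.
    have e1 : ‖g * X * h‖ = ‖X‖ := by
      refine le_antisymm (hle g hg h hh X) ?_
      have e : h * (g * X * h) * g = X := by
        rw [mul_assoc g, ← mul_assoc h g, h1, one_mul, mul_assoc, h1, mul_one]
      calc ‖X‖ = ‖h * (g * X * h) * g‖ := by rw [e]
        _ ≤ _ := hle h hh g hg _
    rw [hc, norm_smul, Real.norm_eq_abs] at e1
    have hcabs : |c| = 1 := (mul_eq_right₀ (norm_ne_zero_iff.2 hX0)).1 e1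
    have hgX : g * X = c • (X * g) := by
      rw [← smul_mul_assoc, ← hc, mul_assoc, h1, mul_one]
    rcases eq_or_eq_neg_of_abs_eq hcabs with rfl | rfl
    · exact Or.inl (by rw [hgX, one_smul])
    · exact Or.inr (by rw [hgX, neg_smul, one_smul])
  have hcommX2 : ∀ g ∈ S, ∀ x, X (X (g x)) = g (X (X x)) := by
    intro g hg x
    rcases hcomm g hg with h | h
    · have h' : ∀ x, g (X x) = X (g x) := fun x => DFunLike.congr_fun h x
      rw [h', h']
    · have h' : ∀ x, g (X x) = -X (g x) := fun x => DFunLike.congr_fun h x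
      rw [h', h', map_neg, neg_neg]
  have hsym : ((X * X : E →L[ℝ] E) : E →ₗ[ℝ] E).IsSymmetric := fun x y => by
    change inner ℝ (X (X x)) y = inner ℝ x (X (X y))
    rw [hS.inner_skew hX, hS.inner_skew hX, neg_neg]
  obtain ⟨μ, hμ⟩ : ∃ μ : ℝ, Module.End.HasEigenvalue ((X * X : E →L[ℝ] E) : E →ₗ[ℝ] E) μ :=
    ⟨_, hsym.hasEigenvalue_iSup_of_finiteDimensional⟩
  obtain ⟨w, hw⟩ := hμ.exists_hasEigenvector
  set W := Module.End.eigenspace ((X * X : E →L[ℝ] E) : E →ₗ[ℝ] E) μ with hW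
  have hWmem : ∀ x, x ∈ W ↔ X (X x) = μ • x := fun x => Module.End.mem_eigenspace_iff
  by_cases hWtop : W = ⊤
  · right
    have hXX : ∀ x, X (X x) = μ • x := fun x => (hWmem x).1 (hWtop ▸ Submodule.mem_top)
    obtain ⟨v, hv⟩ : ∃ v, X v ≠ 0 := by
      by_contra! h
      exact hX0 (ContinuousLinearMap.ext h)
    have hμneg : μ < 0 := by
      have h1 := hS.inner_skew hX (X v) v
      rw [hXX, inner_smul_left, conj_trivial, real_inner_self_eq_norm_sq,
        real_inner_self_eq_norm_sq] at h1
      have h2 : 0 < ‖X v‖ ^ 2 := by positivity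
      by_contra! h3
      have h4 : 0 ≤ μ * ‖v‖ ^ 2 := by positivity
      linarith
    -- Scaling chosen so that `(r X)² = r² μ = -1`.
    set r := (√(-μ))⁻¹ with hr
    have hr2 : r * r * μ = -1 := by
      have h1 : √(-μ) * √(-μ) = -μ := Real.mul_self_sqrt (by linarith)
      rw [hr, ← mul_inv, h1, inv_neg, neg_mul, inv_mul_cancel₀ hμneg.ne]
    have hr0 : r ≠ 0 := by
      rintro h0
      rw [h0] at hr2
      norm_num at hr2
    have hJ : r • X ∈ hS.lie := hS.lie.smul_mem r hX
    have hJJ : ∀ x, (r • X) ((r • X) x) = -x := fun x => by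
      simp only [smul_apply, map_smul, hXX, smul_smul]
      rw [← mul_assoc, hr2, neg_one_smul]
    refine ⟨r • X, hJJ, hS.inner_skew hJ, fun t => ?_, fun g hg => ?_, fun Y hY => ?_⟩
    · rw [← exp_smul_eq_of_sq_eq_neg_one (ContinuousLinearMap.ext hJJ)]
      exact hS.exp_mem hJ t
    · rcases hcomm g hg with h | h
      · have h' : ∀ x, g (X x) = X (g x) := fun x => DFunLike.congr_fun h x
        exact Or.inl fun x => by simp only [smul_apply, map_smul, h']
      · have h' : ∀ x, g (X x) = -X (g x) := fun x => DFunLike.congr_fun h x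
        exact Or.inr fun x => by simp only [smul_apply, map_smul, h', smul_neg]
    · obtain ⟨c, rfl⟩ := hgen Y hY
      exact ⟨c * r⁻¹, by rw [smul_smul, inv_mul_cancel_right₀ hr0]⟩
  · left
    have hperp : Wᗮ ≠ ⊥ := fun h => hWtop (Submodule.orthogonal_eq_bot_iff.1 h)
    obtain ⟨v, hv, hv0⟩ := Submodule.exists_mem_ne_zero_of_ne_bot hperp
    have hw0 : w ≠ 0 := hw.2
    refine ⟨‖w‖⁻¹ • w, ‖v‖⁻¹ • v, ?_, ?_, fun g hg => ?_⟩
    · rw [norm_smul, norm_inv, norm_norm, inv_mul_cancel₀ (norm_ne_zero_iff.2 hw0)]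
    · rw [norm_smul, norm_inv, norm_norm, inv_mul_cancel₀ (norm_ne_zero_iff.2 hv0)]
    · refine (Submodule.mem_orthogonal W _).1 (Wᗮ.smul_mem _ hv) _ ?_
      rw [map_smul]
      refine W.smul_mem _ ((hWmem _).2 ?_)
      rw [hcommX2 g hg, (hWmem w).1 hw.1, map_smul]

end HopfStructure

/-! ### Deep holes of separated sets of lines. -/

section SphericalCovering

theorem Quaternion.inner_eq (p q : Quaternion ℝ) :
    inner ℝ p q = p.re * q.re + p.imI * q.imI + p.imJ * q.imJ + p.imK * q.imK := by
  rw [Quaternion.inner_def]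
  simp

/-- The square of the cosine of the circumradius of a face of the regular icosahedron. -/
noncomputable def icosahedralConst : ℝ := (5 + 2 * √5) / 15

theorem icosahedralConst_gt : 63 / 100 < icosahedralConst := by
  have h : (223 / 100 : ℝ) < √5 := Real.lt_sqrt_of_sq_lt (by norm_num)
  rw [icosahedralConst]
  linarith

variable {V : Type*} [NormedAddCommGroup V] [InnerProductSpace ℝ V]

/-- Normalizing a candidate for a deep hole of a set of points. -/
theorem exists_unit_of_inner_sq_le {L : Set V} {κ : ℝ} {w e : V} (hw : w ≠ 0)
    (he : inner ℝ e w = 0) (h : ∀ p ∈ L, inner ℝ p w ^ 2 ≤ κ * ‖w‖ ^ 2) :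
    ∃ b : V, ‖b‖ = 1 ∧ inner ℝ e b = 0 ∧ ∀ p ∈ L, inner ℝ p b ^ 2 ≤ κ := by
  have hn : 0 < ‖w‖ := norm_pos_iff.2 hw
  refine ⟨‖w‖⁻¹ • w, ?_, ?_, fun p hp => ?_⟩
  · rw [norm_smul, norm_inv, norm_norm, inv_mul_cancel₀ hn.ne']
  · rw [inner_smul_right, he, mul_zero]
  · rw [inner_smul_right, mul_pow, inv_pow, inv_mul_le_iff₀ (by positivity), mul_comm]
    exact h p hp

/-- The hole is the midpoint of `a` and `p`. With `t = ⟨a, p⟩`, the squared cosine is `(1 + t)/2 ≤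
1/2` at the two endpoints, and at most `(2μ)²/(2 + 2t) ≤ 2μ²/(1 - μ)` at any other point of `L` up
to sign. -/
theorem exists_deep_hole_of_pair {L : Set V} {κ μ : ℝ} {e a p : V} (hκ : 1 / 2 ≤ κ)
    (hμ1 : μ < 1) (hμ : 2 * μ ^ 2 ≤ κ * (1 - μ))
    (hL : ∀ p ∈ L, ‖p‖ = 1 ∧ inner ℝ e p = 0)
    (hsep : ∀ p ∈ L, ∀ r ∈ L, p = r ∨ p = -r ∨ |inner ℝ p r| ≤ μ)
    (ha : a ∈ L) (hp : p ∈ L) (hap : |inner ℝ a p| ≤ μ) (hneg : inner ℝ a p ≤ 0) :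
    ∃ b : V, ‖b‖ = 1 ∧ inner ℝ e b = 0 ∧ ∀ p ∈ L, inner ℝ p b ^ 2 ≤ κ := by
  have ha1 : inner ℝ a a = (1 : ℝ) := by rw [real_inner_self_eq_norm_sq, (hL a ha).1, one_pow]
  have hp1 : inner ℝ p p = (1 : ℝ) := by rw [real_inner_self_eq_norm_sq, (hL p hp).1, one_pow]
  have hpa : inner ℝ p a = inner ℝ a p := real_inner_comm _ _
  obtain ⟨t, ht⟩ : ∃ t, t = inner ℝ a p := ⟨_, rfl⟩
  rw [← ht] at hap hneg hpa
  have ht' := abs_le.1 hap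
  have hN : ‖a + p‖ ^ 2 = 2 + 2 * t := by
    rw [← real_inner_self_eq_norm_sq, inner_add_left, inner_add_right, inner_add_right, ha1, hp1,
      hpa, ← ht]
    ring
  refine exists_unit_of_inner_sq_le (w := a + p) ?_ ?_ fun r hr => ?_
  · intro h0
    rw [h0] at hN
    norm_num at hN
    linarith
  · rw [inner_add_right, (hL a ha).2, (hL p hp).2, add_zero]
  have hedge : (1 + t) ^ 2 ≤ κ * (2 + 2 * t) := by nlinarith
  rw [hN, inner_add_right]
  rcases hsep r hr a ha with rfl | rfl | h1
  · rw [ha1, ← ht]; exact hedge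
  · rw [inner_neg_left, inner_neg_left, ha1, ← ht, ← neg_add, neg_sq]; exact hedge
  rcases hsep r hr p hp with rfl | rfl | h2
  · rw [hp1, hpa, add_comm t]; exact hedge
  · rw [inner_neg_left, inner_neg_left, hp1, hpa, ← neg_add, neg_sq, add_comm t]; exact hedge
  have h3 : |inner ℝ r a + inner ℝ r p| ≤ 2 * μ := (abs_add_le _ _).trans (by linarith)
  have h4 : (inner ℝ r a + inner ℝ r p) ^ 2 ≤ (2 * μ) ^ 2 := sq_le_sq' (abs_le.1 h3).1 (abs_le.1 h3).2
  nlinarith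

/-- The hole is the centre of the triangle, and `‖a + p + r‖² = 3 + 6μ`. The squared cosine is `(1 +
2μ)/3` at the vertices and at most `3μ²/(1 + 2μ)` at the other points up to sign. -/
theorem exists_deep_hole_of_triangle {L : Set V} {κ μ : ℝ} {e a p r : V}
    (hκ : 1 + 2 * μ ≤ 3 * κ) (hμ0 : 0 ≤ μ) (hμ : 3 * μ ^ 2 ≤ κ * (1 + 2 * μ))
    (hL : ∀ p ∈ L, ‖p‖ = 1 ∧ inner ℝ e p = 0)
    (hsep : ∀ p ∈ L, ∀ r ∈ L, p = r ∨ p = -r ∨ |inner ℝ p r| ≤ μ)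
    (ha : a ∈ L) (hp : p ∈ L) (hr : r ∈ L) (hap : inner ℝ a p = μ) (har : inner ℝ a r = μ)
    (hpr : inner ℝ p r = μ) :
    ∃ b : V, ‖b‖ = 1 ∧ inner ℝ e b = 0 ∧ ∀ p ∈ L, inner ℝ p b ^ 2 ≤ κ := by
  have hunit : ∀ p ∈ L, inner ℝ p p = (1 : ℝ) := fun p hp => by
    rw [real_inner_self_eq_norm_sq, (hL p hp).1, one_pow]
  have hpa : inner ℝ p a = μ := by rw [real_inner_comm, hap]
  have hra : inner ℝ r a = μ := by rw [real_inner_comm, har]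
  have hrp : inner ℝ r p = μ := by rw [real_inner_comm, hpr]
  have hN : ‖a + p + r‖ ^ 2 = 3 + 6 * μ := by
    rw [← real_inner_self_eq_norm_sq]
    simp only [inner_add_left, inner_add_right, hunit a ha, hunit p hp, hunit r hr, hap, har, hpr,
      hpa, hra, hrp]
    ring
  refine exists_unit_of_inner_sq_le (w := a + p + r) ?_ ?_ fun s hs => ?_
  · intro h0
    rw [h0] at hN
    norm_num at hN
    linarith
  · rw [inner_add_right, inner_add_right, (hL a ha).2, (hL p hp).2, (hL r hr).2]; simp
  have hedge : (1 + 2 * μ) ^ 2 ≤ κ * (3 + 6 * μ) := by nlinarith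
  rw [hN, inner_add_right, inner_add_right]
  have hvert : ∀ v ∈ L, inner ℝ v a + inner ℝ v p + inner ℝ v r = 1 + 2 * μ →
      (s = v ∨ s = -v) → (inner ℝ s a + inner ℝ s p + inner ℝ s r) ^ 2 ≤ κ * (3 + 6 * μ) := by
    rintro v - hv (rfl | rfl)
    · rwa [hv]
    · simp only [inner_neg_left]
      rwa [← neg_add, ← neg_add, neg_sq, hv]
  rcases hsep s hs a ha with h | h | h1
  · exact hvert a ha (by rw [hunit a ha, hap, har]; ring) (Or.inl h)
  · exact hvert a ha (by rw [hunit a ha, hap, har]; ring) (Or.inr h)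
  rcases hsep s hs p hp with h | h | h2
  · exact hvert p hp (by rw [hunit p hp, hpa, hpr]; ring) (Or.inl h)
  · exact hvert p hp (by rw [hunit p hp, hpa, hpr]; ring) (Or.inr h)
  rcases hsep s hs r hr with h | h | h3
  · exact hvert r hr (by rw [hunit r hr, hra, hrp]; ring) (Or.inl h)
  · exact hvert r hr (by rw [hunit r hr, hra, hrp]; ring) (Or.inr h)
  have h4 : |inner ℝ s a + inner ℝ s p + inner ℝ s r| ≤ 3 * μ :=
    (abs_add_le _ _).trans (by linarith [abs_add_le (inner ℝ s a) (inner ℝ s p)])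
  have h5 := sq_le_sq' (abs_le.1 h4).1 (abs_le.1 h4).2
  nlinarith

end SphericalCovering

/-! ### Groups of unit quaternions and the axes of their minimal rotations. -/

section BinaryPolyhedral

open scoped Quaternion

namespace Quaternion

theorem norm_eq_one_iff (q : ℍ[ℝ]) :
    ‖q‖ = 1 ↔ q.re ^ 2 + q.imI ^ 2 + q.imJ ^ 2 + q.imK ^ 2 = 1 := by
  rw [← sq_eq_sq₀ (norm_nonneg q) zero_le_one, ← real_inner_self_eq_norm_sq, inner_eq, one_pow]
  ring_nf

theorem star_mul_self_of_norm_one {q : ℍ[ℝ]} (hq : ‖q‖ = 1) : star q * q = 1 := by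
  rw [Quaternion.star_mul_self, Quaternion.normSq_eq_norm_mul_self, hq]
  simp

theorem self_mul_star_of_norm_one {q : ℍ[ℝ]} (hq : ‖q‖ = 1) : q * star q = 1 := by
  rw [Quaternion.self_mul_star, Quaternion.normSq_eq_norm_mul_self, hq]
  simp

theorem re_star_mul_mul {q : ℍ[ℝ]} (hq : ‖q‖ = 1) (p : ℍ[ℝ]) : (star q * p * q).re = p.re := by
  rw [norm_eq_one_iff] at hq
  have : (star q * p * q).re =
      p.re * (q.re ^ 2 + q.imI ^ 2 + q.imJ ^ 2 + q.imK ^ 2) := by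
    simp
    ring
  rw [this, hq, mul_one]

theorem norm_star_mul_mul {q : ℍ[ℝ]} (hq : ‖q‖ = 1) (p : ℍ[ℝ]) : ‖star q * p * q‖ = ‖p‖ := by
  rw [norm_mul, norm_mul, norm_star, hq, one_mul, mul_one]

theorem re_mul_of_polar (c s : ℝ) {p r : ℍ[ℝ]} (hp : p.re = 0) (hr : r.re = 0) :
    (((c : ℍ[ℝ]) + s • p) * ((c : ℍ[ℝ]) + s • r)).re = c ^ 2 - s ^ 2 * inner ℝ p r := by
  simp [inner_eq, hp, hr]
  ring

/-- Rodrigues' formula for the angle by which a rotation about `a` moves `p`; `c` and `s` are the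
cosine and sine of the half angle. -/
theorem inner_conj_of_polar (c s : ℝ) {a p : ℍ[ℝ]} (ha : a.re = 0) (hp : p.re = 0)
    (ha1 : ‖a‖ = 1) (hp1 : ‖p‖ = 1) :
    inner ℝ p (star ((c : ℍ[ℝ]) + s • a) * p * ((c : ℍ[ℝ]) + s • a)) =
      c ^ 2 - s ^ 2 + 2 * s ^ 2 * inner ℝ a p ^ 2 := by
  rw [norm_eq_one_iff, ha] at ha1
  rw [norm_eq_one_iff, hp] at hp1
  have e : inner ℝ p (star ((c : ℍ[ℝ]) + s • a) * p * ((c : ℍ[ℝ]) + s • a)) =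
      c ^ 2 * (0 ^ 2 + p.imI ^ 2 + p.imJ ^ 2 + p.imK ^ 2) -
      s ^ 2 * (0 ^ 2 + a.imI ^ 2 + a.imJ ^ 2 + a.imK ^ 2) *
        (0 ^ 2 + p.imI ^ 2 + p.imJ ^ 2 + p.imK ^ 2) + 2 * s ^ 2 * inner ℝ a p ^ 2 := by
    simp [inner_eq, ha, hp]
    ring
  rw [e, ha1, hp1]
  ring

theorem inner_conj_axis (c s : ℝ) {a p : ℍ[ℝ]} (ha : a.re = 0) (hp : p.re = 0)
    (hcs : ‖(c : ℍ[ℝ]) + s • a‖ = 1) :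
    inner ℝ a (star ((c : ℍ[ℝ]) + s • a) * p * ((c : ℍ[ℝ]) + s • a)) = inner ℝ a p := by
  rw [norm_eq_one_iff] at hcs
  have e : inner ℝ a (star ((c : ℍ[ℝ]) + s • a) * p * ((c : ℍ[ℝ]) + s • a)) =
      inner ℝ a p * (((c : ℍ[ℝ]) + s • a).re ^ 2 + ((c : ℍ[ℝ]) + s • a).imI ^ 2 +
        ((c : ℍ[ℝ]) + s • a).imJ ^ 2 + ((c : ℍ[ℝ]) + s • a).imK ^ 2) := by
    simp [inner_eq, ha, hp]
    ring
  rw [e, hcs, mul_one]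

/-- The Chebyshev polynomial expressing `cos 5θ` in terms of `cos θ`. -/
theorem re_pow_five (q : ℍ[ℝ]) (hq : ‖q‖ = 1) :
    (q * q * q * q * q).re = 16 * q.re ^ 5 - 20 * q.re ^ 3 + 5 * q.re := by
  rw [norm_eq_one_iff] at hq
  have h : q.imI ^ 2 + q.imJ ^ 2 + q.imK ^ 2 = 1 - q.re ^ 2 := by linarith
  have e : (q * q * q * q * q).re = q.re ^ 5 -
      10 * q.re ^ 3 * (q.imI ^ 2 + q.imJ ^ 2 + q.imK ^ 2) +
      5 * q.re * (q.imI ^ 2 + q.imJ ^ 2 + q.imK ^ 2) ^ 2 := by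
    simp
    ring
  rw [e, h]
  ring

end Quaternion

open Quaternion

/-- A group of unit quaternions in which the minimal rotation angle is attained by `q₀`. -/
structure IsMinimalRotation (Q : Set ℍ[ℝ]) (q₀ : ℍ[ℝ]) : Prop where
  norm_eq_one : ∀ q ∈ Q, ‖q‖ = 1
  mul_mem : ∀ q ∈ Q, ∀ r ∈ Q, q * r ∈ Q
  star_mem : ∀ q ∈ Q, star q ∈ Q
  mem : q₀ ∈ Q
  ne_one : q₀ ≠ 1
  ne_neg_one : q₀ ≠ -1
  abs_re_le : ∀ q ∈ Q, q = 1 ∨ q = -1 ∨ |q.re| ≤ q₀.re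

/-- The axes of the rotations in `Q` with cosine of the half angle `c`. -/
def rotationAxes (Q : Set ℍ[ℝ]) (c s : ℝ) : Set ℍ[ℝ] :=
  {p | ‖p‖ = 1 ∧ p.re = 0 ∧ (c : ℍ[ℝ]) + s • p ∈ Q}

theorem conj_mem_rotationAxes {Q : Set ℍ[ℝ]} {c s : ℝ} {p q : ℍ[ℝ]}
    (hp : p ∈ rotationAxes Q c s) (hq : ‖q‖ = 1) (hconj : ∀ r ∈ Q, star q * r * q ∈ Q) :
    star q * p * q ∈ rotationAxes Q c s := by
  refine ⟨by rw [norm_star_mul_mul hq, hp.1], by rw [re_star_mul_mul hq, hp.2.1], ?_⟩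
  have h := hconj _ hp.2.2
  rw [mul_add, add_mul, mul_smul_comm, smul_mul_assoc, ← Quaternion.coe_commutes, mul_assoc,
    star_mul_self_of_norm_one hq, mul_one] at h
  exact h

namespace IsMinimalRotation

variable {Q : Set ℍ[ℝ]} {q₀ : ℍ[ℝ]} (h : IsMinimalRotation Q q₀)
include h

theorem re_nonneg : 0 ≤ q₀.re := by
  rcases h.abs_re_le q₀ h.mem with h1 | h1 | h1
  · exact absurd h1 h.ne_one
  · exact absurd h1 h.ne_neg_one
  · exact (abs_nonneg _).trans h1

theorem re_lt_one : q₀.re < 1 := by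
  have h1 := (norm_eq_one_iff _).1 (h.norm_eq_one q₀ h.mem)
  by_contra! h2
  have h3 : q₀.imI = 0 := by nlinarith [sq_nonneg q₀.imI, sq_nonneg q₀.imJ, sq_nonneg q₀.imK]
  have h4 : q₀.imJ = 0 := by nlinarith [sq_nonneg q₀.imI, sq_nonneg q₀.imJ, sq_nonneg q₀.imK]
  have h5 : q₀.imK = 0 := by nlinarith [sq_nonneg q₀.imI, sq_nonneg q₀.imJ, sq_nonneg q₀.imK]
  have h6 : q₀.re = 1 := by rw [h3, h4, h5] at h1; nlinarith
  exact h.ne_one (by ext <;> simp [h3, h4, h5, h6])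

theorem exists_axis : ∃ s : ℝ, ∃ a : ℍ[ℝ], s ^ 2 = 1 - q₀.re ^ 2 ∧
    q₀ = (q₀.re : ℍ[ℝ]) + s • a ∧ a ∈ rotationAxes Q q₀.re s := by
  have h1 := (norm_eq_one_iff _).1 (h.norm_eq_one q₀ h.mem)
  have h2 : 0 < 1 - q₀.re ^ 2 := by nlinarith [h.re_nonneg, h.re_lt_one]
  have hs := Real.sq_sqrt h2.le
  have hs0 : √(1 - q₀.re ^ 2) ≠ 0 := (Real.sqrt_pos.2 h2).ne'
  set s := √(1 - q₀.re ^ 2)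
  have hq : q₀ = (q₀.re : ℍ[ℝ]) + s • (s⁻¹ • q₀.im) := by
    rw [smul_smul, mul_inv_cancel₀ hs0, one_smul, Quaternion.re_add_im]
  refine ⟨s, s⁻¹ • q₀.im, hs, hq, ?_, by simp, hq ▸ h.mem⟩
  rw [norm_eq_one_iff]
  simp only [Quaternion.re_smul, Quaternion.imI_smul, Quaternion.imJ_smul, Quaternion.imK_smul,
    Quaternion.re_im, Quaternion.imI_im, Quaternion.imJ_im, Quaternion.imK_im, smul_eq_mul]
  field_simp
  linarith

theorem neg_mem_rotationAxes {s : ℝ} {p : ℍ[ℝ]} (hp : p ∈ rotationAxes Q q₀.re s) :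
    -p ∈ rotationAxes Q q₀.re s := by
  refine ⟨by rw [norm_neg, hp.1], by simp [hp.2.1], ?_⟩
  have h1 := h.star_mem _ hp.2.2
  convert h1 using 1
  ext <;> simp [hp.2.1]

/-- The product of the rotations with axes `p` and `r` has real part `c² - s²⟨p, r⟩`, where `c =
q₀.re`. Unless the product is `±1`, minimality bounds this by `c`, and `s² = (1 - c)(1 + c)` gives
`-⟨p, r⟩ ≤ c/(1 + c)`. Replacing `r` by `-r` gives the other sign. -/
theorem axes_separated {s : ℝ} (hs : s ^ 2 = 1 - q₀.re ^ 2) {p r : ℍ[ℝ]} (hp : p ∈ rotationAxes Q q₀.re s)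
    (hr : r ∈ rotationAxes Q q₀.re s) :
    p = r ∨ p = -r ∨ |inner ℝ p r| ≤ q₀.re / (1 + q₀.re) := by
  have hc0 := h.re_nonneg
  have hc1 := h.re_lt_one
  have hs0 : s ≠ 0 := by
    rintro rfl
    nlinarith
  have key : ∀ p ∈ rotationAxes Q q₀.re s, ∀ r ∈ rotationAxes Q q₀.re s,
      p = r ∨ p = -r ∨ -inner ℝ p r ≤ q₀.re / (1 + q₀.re) := by
    intro p hp r hr
    have hre := re_mul_of_polar q₀.re s hp.2.1 hr.2.1
    set x := (q₀.re : ℍ[ℝ]) + s • p with hx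
    set y := (q₀.re : ℍ[ℝ]) + s • r with hy
    have hxn := h.norm_eq_one _ hp.2.2
    have hinv : ∀ z, x * y = z → y = star x * z := fun z hz => by
      rw [← hz, ← mul_assoc, star_mul_self_of_norm_one hxn, one_mul]
    have hcancel : ∀ i j : ℝ, s * i = s * j → i = j := fun i j hij => mul_left_cancel₀ hs0 hij
    rcases h.abs_re_le _ (h.mul_mem _ hp.2.2 _ hr.2.2) with h1 | h1 | h1
    · right; left
      have h2 := hinv _ h1
      rw [mul_one, Quaternion.ext_iff] at h2
      simp [hx, hy] at h2
      ext
      · simp [hp.2.1, hr.2.1]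
      · exact hcancel _ _ (by simp; linarith)
      · exact hcancel _ _ (by simp; linarith)
      · exact hcancel _ _ (by simp; linarith)
    · left
      have h2 := hinv _ h1
      rw [Quaternion.ext_iff] at h2
      simp [hx, hy, hs0] at h2
      ext
      · simp [hp.2.1, hr.2.1]
      · exact h2.2.1.symm
      · exact h2.2.2.1.symm
      · exact h2.2.2.2.symm
    · right; right
      rw [hre, hs] at h1
      have h2 := (abs_le.1 h1).2
      rw [le_div_iff₀ (by linarith)]
      have h3 : (1 - q₀.re) * (-inner ℝ p r * (1 + q₀.re)) ≤ (1 - q₀.re) * q₀.re := by nlinarith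
      exact le_of_mul_le_mul_left h3 (by linarith)
  rcases key p hp r hr with h1 | h1 | h1
  · exact Or.inl h1
  · exact Or.inr (Or.inl h1)
  rcases key p hp (-r) (h.neg_mem_rotationAxes hr) with h2 | h2 | h2
  · exact Or.inr (Or.inl h2)
  · exact Or.inl (by rw [h2, neg_neg])
  rw [inner_neg_right, neg_neg] at h2
  exact Or.inr (Or.inr (abs_le.2 ⟨by linarith, h2⟩))

end IsMinimalRotation

end BinaryPolyhedral

/-! ### Deep holes of the set of minimal axes. -/

section DeepHole

open scoped Quaternion
open Quaternion

theorem Quaternion.inner_one_left (q : ℍ[ℝ]) : inner ℝ 1 q = q.re := by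
  simp [Quaternion.inner_eq]

theorem Quaternion.polar_mul_self (c s : ℝ) {a : ℍ[ℝ]} (ha : a.re = 0) (ha1 : ‖a‖ = 1) :
    ((c : ℍ[ℝ]) + s • a) * ((c : ℍ[ℝ]) + s • a) =
      ((c ^ 2 - s ^ 2 : ℝ) : ℍ[ℝ]) + (2 * c * s) • a := by
  rw [Quaternion.norm_eq_one_iff, ha] at ha1
  obtain ⟨d, hd⟩ : ∃ d, d = c ^ 2 - s ^ 2 := ⟨_, rfl⟩
  rw [← hd]
  ext
  · simp [ha]
    linear_combination (-s ^ 2) * ha1 - hd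
  · simp [ha]; ring
  · simp [ha]; ring
  · simp [ha]; ring

namespace IsMinimalRotation

variable {Q : Set ℍ[ℝ]} {q₀ : ℍ[ℝ]} (h : IsMinimalRotation Q q₀)
include h

theorem conj_mem_axes {s : ℝ} {p q : ℍ[ℝ]} (hp : p ∈ rotationAxes Q q₀.re s) (hq : q ∈ Q) :
    star q * p * q ∈ rotationAxes Q q₀.re s :=
  conj_mem_rotationAxes hp (h.norm_eq_one q hq) fun _ hr =>
    h.mul_mem _ (h.mul_mem _ (h.star_mem q hq) _ hr) _ hq

/-- If the minimal rotation angle is less than a right angle and there are several axes, then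
the axes are those of the regular icosahedron. -/
theorem icosahedral {s : ℝ} (hs : s ^ 2 = 1 - q₀.re ^ 2) (hc : 1 / 2 < q₀.re ^ 2) {a p : ℍ[ℝ]}
    (ha : a ∈ rotationAxes Q q₀.re s) (hp : p ∈ rotationAxes Q q₀.re s)
    (hap : |inner ℝ a p| ≤ q₀.re / (1 + q₀.re)) :
    4 * q₀.re ^ 2 = 2 * q₀.re + 1 ∧ inner ℝ a p ^ 2 = (q₀.re / (1 + q₀.re)) ^ 2 := by
  have hc0 := h.re_nonneg
  have hc1 := h.re_lt_one
  set c := q₀.re with hcd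
  have hμ1 : c / (1 + c) * (1 + c) = c := div_mul_cancel₀ _ (by linarith)
  have hμ0 : 0 ≤ c / (1 + c) := by positivity
  set μ := c / (1 + c) with hμd
  have hμlt : μ < 1 / 2 := by nlinarith
  obtain ⟨t, ht⟩ : ∃ t, t = inner ℝ a p := ⟨_, rfl⟩
  rw [← ht] at hap ⊢
  have ht2 : t ^ 2 ≤ μ ^ 2 := sq_le_sq' (abs_le.1 hap).1 (abs_le.1 hap).2
  have hp1 : inner ℝ p p = (1 : ℝ) := by rw [real_inner_self_eq_norm_sq, hp.1, one_pow]
  have hsep : ∀ r ∈ rotationAxes Q c s, inner ℝ p r = 1 ∨ inner ℝ p r = -1 ∨ |inner ℝ p r| ≤ μ := by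
    intro r hr
    rcases h.axes_separated hs hp hr with rfl | h1 | h1
    · exact Or.inl hp1
    · right; left
      rw [← neg_eq_iff_eq_neg.2 h1, inner_neg_right, hp1]
    · exact Or.inr (Or.inr h1)
  have hx := ha.2.2
  -- For larger `c`, the minimal rotation about `a` would move `p` to an axis too close to `p`.
  have hc3 : c ^ 2 < 3 / 4 := by
    have hr := inner_conj_of_polar c s ha.2.1 hp.2.1 ha.1 hp.1
    rw [← ht, hs] at hr
    have h1 := hsep _ (h.conj_mem_axes hp hx)
    rw [hr] at h1
    by_contra! h2
    rcases h1 with h1 | h1 | h1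
    · nlinarith
    · nlinarith [sq_nonneg t]
    · have h3 := (abs_le.1 h1).2
      nlinarith [mul_nonneg (show 0 ≤ 1 - c ^ 2 by nlinarith) (sq_nonneg t)]
  -- Write `c = cos θ`. Since `1/2 < c² < 3/4`, `cos 5θ < -c`, so minimality leaves only `x⁵ = -1`.
  -- The equation is then `(c + 1)(4c² - 2c - 1)² = 0`.
  have hfive : 4 * c ^ 2 = 2 * c + 1 := by
    have h5 := h.mul_mem _ (h.mul_mem _ (h.mul_mem _ (h.mul_mem _ hx _ hx) _ hx) _ hx) _ hx
    have hre := re_pow_five _ (h.norm_eq_one _ hx)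
    have hxre : ((c : ℍ[ℝ]) + s • a).re = c := by simp [ha.2.1]
    rw [hxre] at hre
    have hneg : 16 * c ^ 5 - 20 * c ^ 3 + 5 * c < -c := by
      have : 0 < c * ((2 * c ^ 2 - 1) * (3 - 4 * c ^ 2)) := by
        have : 0 < c := by nlinarith
        have : 0 < 2 * c ^ 2 - 1 := by linarith
        have : 0 < 3 - 4 * c ^ 2 := by linarith
        positivity
      nlinarith
    rcases h.abs_re_le _ h5 with h6 | h6 | h6
    · rw [h6, Quaternion.re_one] at hre
      linarith
    · rw [h6, Quaternion.re_neg, Quaternion.re_one] at hre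
      have h7 : (c + 1) * (4 * c ^ 2 - 2 * c - 1) ^ 2 = 0 := by linear_combination -hre
      have h8 := pow_eq_zero_iff (two_ne_zero) |>.1
        ((mul_eq_zero.1 h7).resolve_left (by linarith))
      linarith
    · rw [hre] at h6
      linarith [(abs_le.1 h6).1]
  refine ⟨hfive, le_antisymm ht2 ?_⟩
  -- The square of the minimal rotation moves `p` to an axis whose inner product with `p` is `-c +
  -- (1 + c)t²`. Separation bounds this below by `-μ`, which gives `t² ≥ μ²`.
  have hpolar := polar_mul_self c s ha.2.1 ha.1
  have hr := inner_conj_of_polar (c ^ 2 - s ^ 2) (2 * c * s) ha.2.1 hp.2.1 ha.1 hp.1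
  rw [← hpolar, ← ht] at hr
  have hval : (c ^ 2 - s ^ 2) ^ 2 - (2 * c * s) ^ 2 + 2 * (2 * c * s) ^ 2 * t ^ 2 =
      -c + (1 + c) * t ^ 2 := by
    have h1 : (c ^ 2 - s ^ 2) ^ 2 = (c - 1 / 2) ^ 2 := by
      rw [hs]
      congr 1
      linarith
    have h2 : (2 * c * s) ^ 2 = (1 + c) / 2 := by
      rw [mul_pow, hs]
      linear_combination (1 / 2 - c / 2 - c ^ 2) * hfive
    rw [h1, h2]
    linear_combination (1 / 4) * hfive
  rw [hval] at hr
  have h1 := hsep _ (h.conj_mem_axes hp (h.mul_mem _ hx _ hx))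
  rw [hr] at h1
  rcases h1 with h1 | h1 | h1
  · nlinarith
  · nlinarith [mul_nonneg (show 0 ≤ 1 + c by linarith) (sq_nonneg t)]
  · have h3 := (abs_le.1 h1).1
    have h4 : (1 + c) * μ ^ 2 ≤ (1 + c) * t ^ 2 := by nlinarith
    exact le_of_mul_le_mul_left h4 (by linarith)

theorem exists_deep_hole_axes {s : ℝ} (hs : s ^ 2 = 1 - q₀.re ^ 2) {a : ℍ[ℝ]}
    (ha : a ∈ rotationAxes Q q₀.re s) :
    ∃ b : ℍ[ℝ], ‖b‖ = 1 ∧ inner ℝ 1 b = 0 ∧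
      ∀ p ∈ rotationAxes Q q₀.re s, inner ℝ p b ^ 2 ≤ icosahedralConst := by
  have hκ := icosahedralConst_gt
  have hc0 := h.re_nonneg
  have hc1 := h.re_lt_one
  have hL : ∀ p ∈ rotationAxes Q q₀.re s, ‖p‖ = 1 ∧ inner ℝ 1 p = 0 := fun p hp =>
    ⟨hp.1, by rw [inner_one_left, hp.2.1]⟩
  have hsep := fun p (hp : p ∈ rotationAxes Q q₀.re s) r (hr : r ∈ rotationAxes Q q₀.re s) =>
    h.axes_separated hs hp hr
  by_cases hA : ∀ p ∈ rotationAxes Q q₀.re s, p = a ∨ p = -a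
  · obtain ⟨b, hb, hb1, hb2, -⟩ := exists_unit_orthogonal Quaternion.finrank_eq_four 1 a a
    refine ⟨b, hb, hb1, fun p hp => ?_⟩
    rcases hA p hp with rfl | rfl
    · rw [hb2]; linarith
    · rw [inner_neg_left, hb2]; linarith
  push Not at hA
  obtain ⟨p, hp, hpa, hpa'⟩ := hA
  have hap : |inner ℝ a p| ≤ q₀.re / (1 + q₀.re) := by
    rcases hsep p hp a ha with h1 | h1 | h1
    · exact absurd h1 hpa
    · exact absurd h1 hpa'
    · rwa [real_inner_comm]
  have hμ1 : q₀.re / (1 + q₀.re) * (1 + q₀.re) = q₀.re := div_mul_cancel₀ _ (by linarith)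
  have hμ0 : 0 ≤ q₀.re / (1 + q₀.re) := by positivity
  have hpn := h.neg_mem_rotationAxes hp
  by_cases hc : q₀.re ^ 2 ≤ 1 / 2
  · have hμlt : q₀.re / (1 + q₀.re) < 1 := by nlinarith
    -- The inequality reads `2c² ≤ κ(1 + c)`. At the extreme `c = 1/√2` it needs `κ ≥ 2 - √2`, which
    -- `63/100` exceeds.
    have hμ : 2 * (q₀.re / (1 + q₀.re)) ^ 2 ≤ icosahedralConst * (1 - q₀.re / (1 + q₀.re)) := by
      have e : 1 - q₀.re / (1 + q₀.re) = 1 / (1 + q₀.re) := by field_simp; ring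
      rw [e, div_pow, mul_one_div, ← mul_div_assoc, div_le_div_iff₀ (by positivity) (by linarith)]
      have h1 : q₀.re ≤ 708 / 1000 := by nlinarith
      have h2 : 2 * q₀.re ^ 2 ≤ icosahedralConst * (1 + q₀.re) := by nlinarith
      nlinarith
    rcases le_total (inner ℝ a p) 0 with h0 | h0
    · exact exists_deep_hole_of_pair (by linarith) hμlt hμ hL hsep ha hp hap h0
    · refine exists_deep_hole_of_pair (by linarith) hμlt hμ hL hsep ha hpn ?_ ?_
      · rwa [inner_neg_right, abs_neg]
      · rw [inner_neg_right]; linarith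
  obtain ⟨hfive, ht⟩ := h.icosahedral hs (not_le.1 hc) ha hp hap
  -- Here `c = (1 + √5)/4` and `μ = 1/√5`.
  have hμ : q₀.re / (1 + q₀.re) = (4 * q₀.re - 1) / 5 := by
    rw [div_eq_div_iff (by linarith) (by norm_num)]
    linear_combination -hfive
  have h5 : √5 = 4 * q₀.re - 1 := by
    rw [show (5 : ℝ) = (4 * q₀.re - 1) ^ 2 by linear_combination (-4) * hfive]
    exact Real.sqrt_sq (by nlinarith)
  have hκ' : icosahedralConst = (3 + 8 * q₀.re) / 15 := by rw [icosahedralConst, h5]; ring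
  have key : ∀ p ∈ rotationAxes Q q₀.re s, inner ℝ a p = q₀.re / (1 + q₀.re) →
      ∃ b : ℍ[ℝ], ‖b‖ = 1 ∧ inner ℝ 1 b = 0 ∧
        ∀ p ∈ rotationAxes Q q₀.re s, inner ℝ p b ^ 2 ≤ icosahedralConst := by
    intro p hp hap
    -- The third vertex is `p` rotated about `a` by the minimal rotation; the three axes then span a
    -- face of the icosahedron, whose vertices attain the bound `icosahedralConst`.
    have hr := h.conj_mem_axes hp ha.2.2
    refine exists_deep_hole_of_triangle ?_ hμ0 ?_ hL hsep ha hp hr hap ?_ ?_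
    · rw [hμ, hκ']; linarith
    · rw [hμ, hκ']
      nlinarith
    · rw [inner_conj_axis _ _ ha.2.1 hp.2.1 (h.norm_eq_one _ ha.2.2), hap]
    · rw [inner_conj_of_polar _ _ ha.2.1 hp.2.1 ha.1 hp.1, hap, hs, hμ]
      nlinarith
  rcases sq_eq_sq_iff_eq_or_eq_neg.1 ht with h1 | h1
  · exact key p hp h1
  · exact key (-p) hpn (by rw [inner_neg_right, h1, neg_neg])

/-- Some orbit of the normalizer of `Q` on the two-sphere leaves a cap uncovered whose radius is
the circumradius of a face of the regular icosahedron. -/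
theorem exists_deep_hole :
    ∃ a b : ℍ[ℝ], ‖a‖ = 1 ∧ a.re = 0 ∧ ‖b‖ = 1 ∧ b.re = 0 ∧
      ∀ q : ℍ[ℝ], ‖q‖ = 1 → (∀ r ∈ Q, star q * r * q ∈ Q) →
        inner ℝ (star q * a * q) b ^ 2 ≤ icosahedralConst := by
  obtain ⟨s, a, hs, -, ha⟩ := h.exists_axis
  obtain ⟨b, hb, hb0, hle⟩ := h.exists_deep_hole_axes hs ha
  exact ⟨a, b, ha.1, ha.2.1, hb, by rw [← inner_one_left, hb0], fun q hq hconj =>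
    hle _ (conj_mem_rotationAxes ha hq hconj)⟩

end IsMinimalRotation

end DeepHole

/-! ### Isometries compatible with `i`, and the Hopf map. -/

section HopfAction

open scoped Quaternion
open Quaternion

namespace Quaternion

/-- The quaternion unit `i`. -/
def unitI : ℍ[ℝ] := ⟨0, 1, 0, 0⟩

/-- The quaternion unit `j`. -/
def unitJ : ℍ[ℝ] := ⟨0, 0, 1, 0⟩

@[simp] theorem re_unitI : unitI.re = 0 := rfl
@[simp] theorem imI_unitI : unitI.imI = 1 := rfl
@[simp] theorem imJ_unitI : unitI.imJ = 0 := rfl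
@[simp] theorem imK_unitI : unitI.imK = 0 := rfl
@[simp] theorem re_unitJ : unitJ.re = 0 := rfl
@[simp] theorem imI_unitJ : unitJ.imI = 0 := rfl
@[simp] theorem imJ_unitJ : unitJ.imJ = 1 := rfl
@[simp] theorem imK_unitJ : unitJ.imK = 0 := rfl

theorem norm_unitI : ‖unitI‖ = 1 := by simp [norm_eq_one_iff]

theorem norm_unitJ : ‖unitJ‖ = 1 := by simp [norm_eq_one_iff]

theorem exists_cos_sin {a b : ℝ} (h : a ^ 2 + b ^ 2 = 1) :
    ∃ t : ℝ, Real.cos t = a ∧ Real.sin t = b := by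
  have hn : ‖(⟨a, b⟩ : ℂ)‖ = 1 := by
    rw [Complex.norm_def, Complex.normSq_mk, Real.sqrt_eq_one]
    linarith
  obtain ⟨t, ht⟩ := (Complex.norm_eq_one_iff _).1 hn
  refine ⟨t, ?_, ?_⟩
  · rw [← Complex.exp_ofReal_mul_I_re, ht]
  · rw [← Complex.exp_ofReal_mul_I_im, ht]

/-- Isometries of the quaternions that are linear for the left multiplication by `i`. -/
theorem exists_eq_mul_mul_of_comm (f : ℍ[ℝ] →ₗ[ℝ] ℍ[ℝ]) (hf : ∀ x, ‖f x‖ = ‖x‖)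
    (hI : ∀ x, f (unitI * x) = unitI * f x) :
    ∃ u q : ℍ[ℝ], ‖u‖ = 1 ∧ ‖q‖ = 1 ∧ star u * unitI * u = unitI ∧ ∀ x, f x = u * x * q := by
  have hq1 : ‖f 1‖ = 1 := by rw [hf, norm_one]
  have hinner : ∀ x y, inner ℝ (f x) (f y) = inner ℝ x y := fun x y => by
    rw [real_inner_eq_norm_add_mul_self_sub_norm_mul_self_sub_norm_mul_self_div_two,
      real_inner_eq_norm_add_mul_self_sub_norm_mul_self_sub_norm_mul_self_div_two,
      ← map_add, hf, hf, hf]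
  -- The unit quaternion `w` lies in the span of `j` and `k`, so `w = v̄ j v` with `v = cos (t/2) +
  -- sin (t/2) i`. Then `x ↦ v̄ x (v f(1))` agrees with `f` at `1` and `j`, hence everywhere.
  obtain ⟨w, hw⟩ : ∃ w, w = f unitJ * star (f 1) := ⟨_, rfl⟩
  have hfJ : f unitJ = w * f 1 := by
    rw [hw, mul_assoc, star_mul_self_of_norm_one hq1, mul_one]
  have hwn : ‖w‖ = 1 := by rw [hw, norm_mul, norm_star, hq1, hf, norm_unitJ, mul_one]
  have hwre : w.re = 0 := by
    rw [hw, ← Quaternion.inner_def, hinner]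
    simp [inner_eq]
  have hwI : w.imI = 0 := by
    have h1 : inner ℝ (f unitJ) (f (unitI * 1)) = 0 := by
      rw [hinner]
      simp [inner_eq]
    rw [hI, Quaternion.inner_def, StarMul.star_mul, ← mul_assoc, ← hw] at h1
    simpa using h1
  obtain ⟨t, ht1, ht2⟩ := exists_cos_sin (a := w.imJ) (b := -w.imK) (by
    rw [norm_eq_one_iff, hwre, hwI] at hwn
    linarith)
  obtain ⟨c, hc⟩ : ∃ c, c = Real.cos (t / 2) := ⟨_, rfl⟩
  obtain ⟨s, hs⟩ : ∃ s, s = Real.sin (t / 2) := ⟨_, rfl⟩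
  have hcs : c ^ 2 + s ^ 2 = 1 := by rw [hc, hs, Real.cos_sq_add_sin_sq]
  have hwJ : w.imJ = c ^ 2 - s ^ 2 := by
    rw [← ht1, hc, hs, ← Real.cos_two_mul', mul_div_cancel₀ _ two_ne_zero]
  have hwK : w.imK = -(2 * s * c) := by
    rw [hc, hs, ← Real.sin_two_mul, mul_div_cancel₀ _ two_ne_zero, ht2, neg_neg]
  obtain ⟨v, hv0, hv1, hv2, hv3⟩ : ∃ v : ℍ[ℝ], v.re = c ∧ v.imI = s ∧ v.imJ = 0 ∧ v.imK = 0 :=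
    ⟨⟨c, s, 0, 0⟩, rfl, rfl, rfl, rfl⟩
  have hvn : ‖v‖ = 1 := by
    rw [norm_eq_one_iff, hv0, hv1, hv2, hv3]
    simpa using hcs
  have hwv : w = star v * unitJ * v := by
    ext
    · simp [hwre, hv0, hv1, hv2, hv3]
    · simp [hwI, hv0, hv1, hv2, hv3]
    · simp [hwJ, hv0, hv1, hv2, hv3]; ring
    · simp [hwK, hv0, hv1, hv2, hv3]; ring
  have hvI : v * unitI = unitI * v := by
    ext <;> simp [hv2, hv3]
  have hsvI : star v * unitI = unitI * star v := by
    ext <;> simp [hv2, hv3]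
  refine ⟨star v, v * f 1, by rw [norm_star, hvn], by rw [norm_mul, hvn, hq1, one_mul], ?_, ?_⟩
  · rw [star_star, hvI, mul_assoc, self_mul_star_of_norm_one hvn, mul_one]
  · intro x
    have hx : x = x.re • (1 : ℍ[ℝ]) + x.imI • (unitI * 1) + x.imJ • unitJ +
        x.imK • (unitI * unitJ) := by
      ext <;> simp
    have h1 : f 1 = star v * 1 * (v * f 1) := by
      rw [mul_one, ← mul_assoc, star_mul_self_of_norm_one hvn, one_mul]
    have h2 : f (unitI * 1) = star v * (unitI * 1) * (v * f 1) := by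
      rw [hI, mul_one, hsvI, mul_assoc, ← mul_assoc (star v), star_mul_self_of_norm_one hvn,
        one_mul]
    have h3 : f unitJ = star v * unitJ * (v * f 1) := by rw [hfJ, hwv, mul_assoc]
    have h4 : f (unitI * unitJ) = star v * (unitI * unitJ) * (v * f 1) := by
      rw [hI, h3, ← mul_assoc (star v) unitI, hsvI]
      simp only [mul_assoc]
    have h5 : f x = x.re • f 1 + x.imI • f (unitI * 1) + x.imJ • f unitJ +
        x.imK • f (unitI * unitJ) := by
      conv_lhs => rw [hx]
      simp only [map_add, map_smul]
    obtain ⟨r, hr⟩ : ∃ r, r = v * f 1 := ⟨_, rfl⟩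
    rw [← hr] at h1 h2 h3 h4 ⊢
    rw [h5, h2, h3, h4, h1]
    conv_rhs => rw [hx]
    simp only [mul_add, add_mul, mul_smul_comm, smul_mul_assoc]

/-- Left multiplication by `j` anticommutes with that by `i`, so composing with it reduces to the
commuting case. -/
theorem exists_eq_mul_mul_of_anticomm (f : ℍ[ℝ] →ₗ[ℝ] ℍ[ℝ]) (hf : ∀ x, ‖f x‖ = ‖x‖)
    (hI : ∀ x, f (unitI * x) = -(unitI * f x)) :
    ∃ u q : ℍ[ℝ], ‖u‖ = 1 ∧ ‖q‖ = 1 ∧ star u * unitI * u = -unitI ∧ ∀ x, f x = u * x * q := by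
  have hJI : unitJ * unitI = -(unitI * unitJ) := by ext <;> simp
  have hJJ : unitJ * unitJ = -1 := by ext <;> simp
  have hJIJ : unitJ * unitI * unitJ = unitI := by ext <;> simp
  have hsJ : star unitJ = -unitJ := by ext <;> simp
  obtain ⟨u, q, hu, hq, hIu, hfx⟩ := exists_eq_mul_mul_of_comm
    ((LinearMap.mulLeft ℝ unitJ).comp f)
    (fun x => by simp [norm_unitJ, hf])
    (fun x => by
      simp only [LinearMap.comp_apply, LinearMap.mulLeft_apply, hI]
      rw [mul_neg, ← mul_assoc, hJI, neg_mul, neg_neg, mul_assoc])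
  simp only [LinearMap.comp_apply, LinearMap.mulLeft_apply] at hfx
  refine ⟨-(unitJ * u), q, by rw [norm_neg, norm_mul, norm_unitJ, hu, one_mul], hq, ?_, ?_⟩
  · rw [star_neg, StarMul.star_mul, hsJ]
    calc -(star u * -unitJ) * unitI * -(unitJ * u)
        = -(star u * (unitJ * unitI * unitJ) * u) := by noncomm_ring
      _ = -unitI := by rw [hJIJ, hIu]
  · intro x
    calc f x = -(unitJ * unitJ * f x) := by rw [hJJ]; simp
      _ = -(unitJ * (unitJ * f x)) := by rw [mul_assoc]
      _ = _ := by rw [hfx]; noncomm_ring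

/-- The Hopf map doubles the distance between circles. The two sides differ by twice the square of
the `i`-component of `x ȳ`. -/
theorem two_mul_inner_sq_le {x y : ℍ[ℝ]} (hx : ‖x‖ = 1) (hy : ‖y‖ = 1) :
    2 * inner ℝ x y ^ 2 ≤ 1 + inner ℝ (star x * unitI * x) (star y * unitI * y) := by
  rw [norm_eq_one_iff] at hx hy
  have e : inner ℝ (star x * unitI * x) (star y * unitI * y) =
      2 * inner ℝ x y ^ 2 + 2 * (x * star y).imI ^ 2 -
        (x.re ^ 2 + x.imI ^ 2 + x.imJ ^ 2 + x.imK ^ 2) *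
          (y.re ^ 2 + y.imI ^ 2 + y.imJ ^ 2 + y.imK ^ 2) := by
    simp [inner_eq]
    ring
  rw [hx, hy] at e
  rw [e]
  nlinarith [sq_nonneg (x * star y).imI]

/-- The Hopf map is onto. -/
theorem exists_star_mul_unitI_mul {a : ℍ[ℝ]} (ha : ‖a‖ = 1) (hre : a.re = 0) :
    ∃ x : ℍ[ℝ], ‖x‖ = 1 ∧ star x * unitI * x = a := by
  by_cases h0 : unitI + a = 0
  · refine ⟨unitJ, norm_unitJ, ?_⟩
    rw [eq_neg_of_add_eq_zero_right h0]
    ext <;> simp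
  · have hn : ‖unitI + a‖ ≠ 0 := norm_ne_zero_iff.2 h0
    have hx : ‖‖unitI + a‖⁻¹ • (unitI + a)‖ = 1 := by
      rw [norm_smul, norm_inv, norm_norm, inv_mul_cancel₀ hn]
    have haa : a * a = -1 := by
      rw [norm_eq_one_iff, hre] at ha
      ext <;> simp [hre]
      · linarith
      all_goals ring
    have hII : unitI * unitI = -1 := by ext <;> simp
    have hcomm : unitI * (‖unitI + a‖⁻¹ • (unitI + a)) = (‖unitI + a‖⁻¹ • (unitI + a)) * a := by
      -- Both sides equal `i a - 1`, because `i² = a² = -1`.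
      have : unitI * (unitI + a) = (unitI + a) * a := by
        rw [mul_add, add_mul, haa, hII]
        exact add_comm _ _
      rw [mul_smul_comm, smul_mul_assoc, this]
    refine ⟨_, hx, ?_⟩
    rw [mul_assoc, hcomm, ← mul_assoc, star_mul_self_of_norm_one hx, one_mul]

end Quaternion

end HopfAction

/-! ### The group in quaternionic coordinates. -/

section Sandwich

open scoped Quaternion
open Quaternion

variable {E : Type*} [NormedAddCommGroup E] [InnerProductSpace ℝ E] [FiniteDimensional ℝ E]

/-- The operator `x ↦ u x q` on the quaternions, transported to `E`. -/
noncomputable def sandwich (Ψ : ℍ[ℝ] ≃ₗᵢ[ℝ] E) (u q : ℍ[ℝ]) : E →L[ℝ] E :=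
  (Ψ.toContinuousLinearEquiv : ℍ[ℝ] →L[ℝ] E) ∘L
    (ContinuousLinearMap.mulLeftRight ℝ ℍ[ℝ] u q) ∘L
      (Ψ.symm.toContinuousLinearEquiv : E →L[ℝ] ℍ[ℝ])

variable (Ψ : ℍ[ℝ] ≃ₗᵢ[ℝ] E)

omit [FiniteDimensional ℝ E] in
theorem sandwich_apply (u q x : ℍ[ℝ]) : sandwich Ψ u q (Ψ x) = Ψ (u * x * q) := by
  simp [sandwich]

theorem eq_sandwich_of_apply {g : E →L[ℝ] E} {u q : ℍ[ℝ]} (h : ∀ x, g (Ψ x) = Ψ (u * x * q)) :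
    g = sandwich Ψ u q := by
  ext y
  obtain ⟨x, rfl⟩ := Ψ.surjective y
  rw [h, sandwich_apply]

theorem sandwich_one_one : sandwich Ψ 1 1 = 1 :=
  (eq_sandwich_of_apply Ψ fun x => by simp).symm

theorem sandwich_mul (u q u' q' : ℍ[ℝ]) :
    sandwich Ψ u q * sandwich Ψ u' q' = sandwich Ψ (u * u') (q' * q) :=
  eq_sandwich_of_apply Ψ fun x => by
    rw [mul_apply_eq_comp, sandwich_apply, sandwich_apply]
    simp only [mul_assoc]

/-- Right multiplications as a linear map. -/
noncomputable def rightMul : ℍ[ℝ] →ₗ[ℝ] E →L[ℝ] E where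
  toFun q := sandwich Ψ 1 q
  map_add' p q := by
    ext y
    obtain ⟨x, rfl⟩ := Ψ.surjective y
    simp [sandwich_apply, mul_add]
  map_smul' c q := by
    ext y
    obtain ⟨x, rfl⟩ := Ψ.surjective y
    simp [sandwich_apply]

theorem rightMul_apply (q x : ℍ[ℝ]) : rightMul Ψ q (Ψ x) = Ψ (x * q) := by
  simp [rightMul, sandwich_apply]

theorem continuous_rightMul : Continuous (rightMul Ψ) :=
  LinearMap.continuous_of_finiteDimensional _

theorem rightMul_injective : Function.Injective (rightMul Ψ) := fun p q h => by
  have h1 := DFunLike.congr_fun h (Ψ 1)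
  rw [rightMul_apply, rightMul_apply, one_mul, one_mul] at h1
  exact Ψ.injective h1

theorem rightMul_one : rightMul Ψ 1 = 1 := sandwich_one_one Ψ

theorem rightMul_mul (p q : ℍ[ℝ]) : rightMul Ψ (p * q) = rightMul Ψ q * rightMul Ψ p := by
  change sandwich Ψ 1 (p * q) = sandwich Ψ 1 q * sandwich Ψ 1 p
  rw [sandwich_mul, one_mul]

/-- The unit quaternions whose right multiplications belong to `S`. -/
def rightGroup (S : Submonoid (E →L[ℝ] E)) : Set ℍ[ℝ] :=
  {q | ‖q‖ = 1 ∧ rightMul Ψ q ∈ S}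

variable [CompleteSpace E] {S : Submonoid (E →L[ℝ] E)} {hS : IsClosedOrthogonal S}
  {J : E →L[ℝ] E}

/-- For a unit `e` and a unit `f` orthogonal to `e` and `J e`, the orthonormal basis `e, J e, f, J
f` plays the role of `1, i, j, k`. -/
theorem IsHopf.exists_quaternion_model (hE : Module.finrank ℝ E = 4) (hJ : IsHopf hS J) :
    ∃ Ψ : ℍ[ℝ] ≃ₗᵢ[ℝ] E, ∀ q, Ψ (unitI * q) = J (Ψ q) := by
  have hJi : ∀ x y, inner ℝ (J x) (J y) = inner ℝ x y := fun x y => by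
    rw [hJ.skew, hJ.apply_apply, inner_neg_right, neg_neg]
  have hJ0 : ∀ x, inner ℝ (J x) x = 0 := fun x => by
    have h1 := hJ.skew x x
    rw [real_inner_comm] at h1 ⊢
    linarith
  obtain ⟨e, he, -⟩ := exists_unit_orthogonal hE 0 0 0
  obtain ⟨f, hf, hef, hJef, -⟩ := exists_unit_orthogonal hE e (J e) 0
  have hee : inner ℝ e e = (1 : ℝ) := by rw [real_inner_self_eq_norm_sq, he, one_pow]
  have hff : inner ℝ f f = (1 : ℝ) := by rw [real_inner_self_eq_norm_sq, hf, one_pow]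
  have heJe : inner ℝ e (J e) = 0 := by rw [real_inner_comm, hJ0]
  have hfJf : inner ℝ f (J f) = 0 := by rw [real_inner_comm, hJ0]
  have heJf : inner ℝ e (J f) = 0 := by
    have := hJ.skew e f
    rw [hJef] at this
    linarith
  have hfe : inner ℝ f e = 0 := by rw [real_inner_comm, hef]
  have hfJe : inner ℝ f (J e) = 0 := by rw [real_inner_comm, hJef]
  have hJfe : inner ℝ (J f) e = 0 := by rw [real_inner_comm, heJf]
  let φ : ℍ[ℝ] →ₗ[ℝ] E :=
    { toFun := fun q => q.re • e + q.imI • J e + q.imJ • f + q.imK • J f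
      map_add' := fun p q => by simp; module
      map_smul' := fun c q => by simp; module }
  have hφ : ∀ q, φ q = q.re • e + q.imI • J e + q.imJ • f + q.imK • J f := fun q => rfl
  have hnorm : ∀ q, ‖φ q‖ = ‖q‖ := fun q => by
    rw [← sq_eq_sq₀ (norm_nonneg _) (norm_nonneg _), ← real_inner_self_eq_norm_sq,
      ← real_inner_self_eq_norm_sq, hφ, inner_eq]
    simp only [inner_add_left, inner_add_right, inner_smul_left, inner_smul_right, conj_trivial,
      hJi, hee, hff, heJe, hfJf, heJf, hfe, hfJe, hJfe, hef, hJef, hJ0]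
    ring
  let φi : ℍ[ℝ] →ₗᵢ[ℝ] E := ⟨φ, hnorm⟩
  refine ⟨φi.toLinearIsometryEquiv (by rw [Quaternion.finrank_eq_four, hE]), fun q => ?_⟩
  change φ (unitI * q) = J (φ q)
  simp only [hφ, map_add, map_smul, hJ.apply_apply]
  simp
  module

variable {Ψ} (hJ : IsHopf hS J) (hΨ : ∀ q, Ψ (unitI * q) = J (Ψ q))
include hJ hΨ

theorem IsHopf.exists_eq_sandwich {g : E →L[ℝ] E} (hg : g ∈ S) :
    ∃ u q : ℍ[ℝ], ‖u‖ = 1 ∧ ‖q‖ = 1 ∧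
      (star u * unitI * u = unitI ∨ star u * unitI * u = -unitI) ∧ g = sandwich Ψ u q := by
  let f : ℍ[ℝ] →ₗ[ℝ] ℍ[ℝ] :=
    Ψ.symm.toLinearEquiv.toLinearMap ∘ₗ (g : E →ₗ[ℝ] E) ∘ₗ Ψ.toLinearEquiv.toLinearMap
  have hf : ∀ x, f x = Ψ.symm (g (Ψ x)) := fun x => rfl
  have hnorm : ∀ x, ‖f x‖ = ‖x‖ := fun x => by
    rw [hf, LinearIsometryEquiv.norm_map, hS.norm_apply g hg, LinearIsometryEquiv.norm_map]
  have hfg : ∀ x, g (Ψ x) = Ψ (f x) := fun x => by rw [hf, LinearIsometryEquiv.apply_symm_apply]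
  rcases hJ.comm_or g hg with h | h
  · obtain ⟨u, q, hu, hq, hI, hx⟩ := exists_eq_mul_mul_of_comm f hnorm fun x => by
      apply Ψ.injective
      rw [hΨ, ← hfg, hΨ, h, hfg]
    exact ⟨u, q, hu, hq, Or.inl hI, eq_sandwich_of_apply Ψ fun x => by rw [hfg, hx]⟩
  · obtain ⟨u, q, hu, hq, hI, hx⟩ := exists_eq_mul_mul_of_anticomm f hnorm fun x => by
      apply Ψ.injective
      rw [map_neg, hΨ, ← hfg, hΨ, h, hfg]
    exact ⟨u, q, hu, hq, Or.inr hI, eq_sandwich_of_apply Ψ fun x => by rw [hfg, hx]⟩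

/-- A unit quaternion commuting with `i` lies on the circle through `1` and `i`. This allows the
left factor of an element of `S` to be stripped off. -/
theorem IsHopf.sandwich_circle_mem {u : ℍ[ℝ]} (hu : ‖u‖ = 1)
    (hI : star u * unitI * u = unitI) : sandwich Ψ (star u) 1 ∈ S := by
  have hc : unitI * u = u * unitI := by
    conv_rhs => rw [← hI]
    rw [← mul_assoc, ← mul_assoc, self_mul_star_of_norm_one hu, one_mul]
  rw [Quaternion.ext_iff] at hc
  simp at hc
  have h2 : u.imJ = 0 := by linarith [hc.2]
  have h3 : u.imK = 0 := by linarith [hc.1]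
  obtain ⟨t, ht1, ht2⟩ := exists_cos_sin (a := u.re) (b := -u.imI) (by
    rw [norm_eq_one_iff, h2, h3] at hu
    linarith)
  convert hJ.circle_mem t using 1
  symm
  refine eq_sandwich_of_apply Ψ fun x => ?_
  have hu' : star u = Real.cos t • (1 : ℍ[ℝ]) + Real.sin t • unitI := by
    ext <;> simp [ht1, ht2, h2, h3]
  rw [hu']
  simp [add_mul, hΨ]

theorem IsHopf.mem_rightGroup {u q : ℍ[ℝ]} (hu : ‖u‖ = 1) (hq : ‖q‖ = 1)
    (hI : star u * unitI * u = unitI) (h : sandwich Ψ u q ∈ S) : q ∈ rightGroup Ψ S := by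
  refine ⟨hq, ?_⟩
  have h1 := S.mul_mem (hJ.sandwich_circle_mem hΨ hu hI) h
  rwa [sandwich_mul, star_mul_self_of_norm_one hu, mul_one] at h1

omit [CompleteSpace E] hJ hΨ in
theorem sandwich_star_mem (hS : IsClosedOrthogonal S) {u q : ℍ[ℝ]} (hu : ‖u‖ = 1) (hq : ‖q‖ = 1)
    (h : sandwich Ψ u q ∈ S) : sandwich Ψ (star u) (star q) ∈ S := by
  obtain ⟨g, hg, h1, -⟩ := hS.exists_inv _ h
  have h2 : sandwich Ψ u q * sandwich Ψ (star u) (star q) = 1 := by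
    rw [sandwich_mul, self_mul_star_of_norm_one hu, star_mul_self_of_norm_one hq, sandwich_one_one]
  rwa [← left_inv_eq_right_inv h1 h2]

-- The right factor of any element of `S` normalizes the group of right multiplications, because the
-- left factors cancel in the conjugation.
omit hJ hΨ in
theorem conj_mem_rightGroup (hS : IsClosedOrthogonal S) {u q : ℍ[ℝ]} (hu : ‖u‖ = 1)
    (hq : ‖q‖ = 1) (h : sandwich Ψ u q ∈ S) {r : ℍ[ℝ]} (hr : r ∈ rightGroup Ψ S) :
    star q * r * q ∈ rightGroup Ψ S := by
  refine ⟨by rw [norm_star_mul_mul hq, hr.1], ?_⟩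
  have h1 := S.mul_mem (S.mul_mem h hr.2) (sandwich_star_mem hS hu hq h)
  change sandwich Ψ u q * sandwich Ψ 1 r * _ ∈ S at h1
  rw [sandwich_mul, sandwich_mul, mul_one, self_mul_star_of_norm_one hu, ← mul_assoc] at h1
  exact h1

omit hΨ in
theorem IsHopf.neg_mem_rightGroup {q : ℍ[ℝ]} (hq : q ∈ rightGroup Ψ S) :
    -q ∈ rightGroup Ψ S := by
  refine ⟨by rw [norm_neg, hq.1], ?_⟩
  have h1 := S.mul_mem (hJ.circle_mem Real.pi) hq.2
  rw [map_neg]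
  simpa using h1

/-- The identity is isolated in the group of right multiplications. -/
theorem IsHopf.eventually_eq_one {u : ℕ → ℍ[ℝ]} (hu : ∀ n, u n ∈ rightGroup Ψ S)
    (hlim : Tendsto u atTop (𝓝 1)) : ∃ n, u n = 1 := by
  by_contra! hne
  obtain ⟨Z, hZ, hZ0, ⟨p, rfl⟩⟩ := exists_mem_lieAlg_of_tendsto hS.isClosed hS.norm_le_one
    hS.exists_left_inv (u := fun n => rightMul Ψ (u n)) (fun n => (hu n).2)
    (fun n h => hne n (rightMul_injective Ψ (h.trans (rightMul_one Ψ).symm)))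
    (by simpa [Function.comp_def, rightMul_one] using
      ((continuous_rightMul Ψ).tendsto 1).comp hlim)
    (LinearMap.range (rightMul Ψ))
    (fun n => ⟨u n - 1, by rw [map_sub, rightMul_one]⟩)
  -- The limit direction is both a right multiplication and a multiple of `J`, so `x p = c i x` for
  -- all `x`. Taking `x = 1` and then `x = j` gives `c = 0`.
  obtain ⟨c, hc⟩ := hJ.lie_eq _ hZ
  have h1 : ∀ x, x * p = c • (unitI * x) := fun x => by
    apply Ψ.injective
    rw [← rightMul_apply, hc, map_smul, hΨ, smul_apply]
  have hp := h1 1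
  rw [one_mul, mul_one] at hp
  have h2 := h1 unitJ
  rw [hp, Quaternion.ext_iff] at h2
  simp at h2
  have hc0 : c = 0 := by linarith
  rw [hp, hc0, zero_smul, map_zero] at hZ0
  exact hZ0 rfl

/-- Since `1` and `-1` are isolated, removing them leaves a compact set, on which the real part
attains its maximum. -/
theorem IsHopf.exists_isMinimalRotation (hne : ∃ q ∈ rightGroup Ψ S, q ≠ 1 ∧ q ≠ -1) :
    ∃ q₀, IsMinimalRotation (rightGroup Ψ S) q₀ := by
  set K : Set ℍ[ℝ] := {q | q ∈ rightGroup Ψ S ∧ q ≠ 1 ∧ q ≠ -1} with hK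
  have hQcl : IsClosed (rightGroup Ψ S) :=
    (isClosed_eq continuous_norm continuous_const).inter
      (hS.isClosed.preimage (continuous_rightMul Ψ))
  have hKcl : IsClosed K := by
    refine IsSeqClosed.isClosed fun u q hu hlim => ?_
    refine ⟨hQcl.mem_of_tendsto hlim (Eventually.of_forall fun n => (hu n).1), ?_, ?_⟩
    · rintro rfl
      obtain ⟨n, hn⟩ := hJ.eventually_eq_one hΨ (fun n => (hu n).1) hlim
      exact (hu n).2.1 hn
    · rintro rfl
      obtain ⟨n, hn⟩ := hJ.eventually_eq_one hΨ (u := fun n => -u n)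
        (fun n => hJ.neg_mem_rightGroup (hu n).1) (by simpa using hlim.neg)
      exact (hu n).2.2 (neg_eq_iff_eq_neg.1 hn)
  have : ProperSpace ℍ[ℝ] := FiniteDimensional.proper ℝ _
  have hKc : IsCompact K :=
    (isCompact_sphere (0 : ℍ[ℝ]) 1).of_isClosed_subset hKcl fun q hq =>
      mem_sphere_zero_iff_norm.2 hq.1.1
  obtain ⟨q₀, hq₀, hmax⟩ := hKc.exists_isMaxOn hne Quaternion.continuous_re.continuousOn
  refine ⟨q₀, fun q hq => hq.1, fun q hq r hr => ⟨?_, ?_⟩, fun q hq => ⟨?_, ?_⟩, hq₀.1, hq₀.2.1,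
    hq₀.2.2, fun q hq => ?_⟩
  · rw [norm_mul, hq.1, hr.1, one_mul]
  · rw [rightMul_mul]
    exact S.mul_mem hr.2 hq.2
  · rw [norm_star, hq.1]
  · have := sandwich_star_mem hS norm_one hq.1 hq.2
    rwa [star_one] at this
  · by_cases h1 : q = 1
    · exact Or.inl h1
    by_cases h2 : q = -1
    · exact Or.inr (Or.inl h2)
    refine Or.inr (Or.inr (abs_le.2 ⟨?_, hmax ⟨hq, h1, h2⟩⟩))
    have h3 : -q ∈ K := ⟨hJ.neg_mem_rightGroup hq, fun h => h2 (neg_eq_iff_eq_neg.1 h),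
      fun h => h1 (neg_injective h)⟩
    have h4 : (-q).re ≤ q₀.re := hmax h3
    rw [Quaternion.re_neg] at h4
    linarith

/-- Elements commuting with `J` have `q = ±1`. Two anticommuting ones differ by a commuting one, so
they share `q` up to sign. The images of `i` thus span at most two lines. -/
theorem IsHopf.exists_deep_hole_of_trivial (hQ : ∀ q ∈ rightGroup Ψ S, q = 1 ∨ q = -1) :
    ∃ b : ℍ[ℝ], ‖b‖ = 1 ∧ b.re = 0 ∧
      ∀ u q : ℍ[ℝ], ‖u‖ = 1 → ‖q‖ = 1 →
        (star u * unitI * u = unitI ∨ star u * unitI * u = -unitI) → sandwich Ψ u q ∈ S →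
          inner ℝ (star q * unitI * q) b = 0 := by
  by_cases h0 : ∃ u₀ q₀ : ℍ[ℝ], ‖u₀‖ = 1 ∧ ‖q₀‖ = 1 ∧ star u₀ * unitI * u₀ = -unitI ∧
      sandwich Ψ u₀ q₀ ∈ S
  · obtain ⟨u₀, q₀, hu₀, hq₀, hI₀, hmem₀⟩ := h0
    obtain ⟨b, hb, hb1, hbI, hbq⟩ := exists_unit_orthogonal Quaternion.finrank_eq_four 1 unitI
      (star q₀ * unitI * q₀)
    refine ⟨b, hb, by rw [← inner_one_left, hb1], fun u q hu hq hI hmem => ?_⟩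
    rcases hI with hI | hI
    · rcases hQ q (hJ.mem_rightGroup hΨ hu hq hI hmem) with rfl | rfl
      · simpa using hbI
      · simpa using hbI
    · have h1 := S.mul_mem (sandwich_star_mem hS hu₀ hq₀ hmem₀) hmem
      rw [sandwich_mul] at h1
      have hI' : u₀ * unitI * star u₀ = -unitI := by
        have : u₀ * (star u₀ * unitI * u₀) * star u₀ = -(u₀ * unitI * star u₀) := by
          rw [hI₀]; noncomm_ring
        rw [← neg_eq_iff_eq_neg, ← this]
        have e := self_mul_star_of_norm_one hu₀
        calc u₀ * (star u₀ * unitI * u₀) * star u₀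
            = (u₀ * star u₀) * unitI * (u₀ * star u₀) := by noncomm_ring
          _ = unitI := by rw [e, one_mul, mul_one]
      have h2 : star (star u₀ * u) * unitI * (star u₀ * u) = unitI := by
        rw [StarMul.star_mul, star_star]
        calc star u * u₀ * unitI * (star u₀ * u)
            = star u * (u₀ * unitI * star u₀) * u := by noncomm_ring
          _ = -(star u * unitI * u) := by rw [hI']; noncomm_ring
          _ = unitI := by rw [hI, neg_neg]
      have h3 := hQ _ (hJ.mem_rightGroup hΨ (by rw [norm_mul, norm_star, hu₀, hu, one_mul])
        (by rw [norm_mul, norm_star, hq₀, hq, one_mul]) h2 h1)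
      have hq' : q = q * star q₀ * q₀ := by
        rw [mul_assoc, star_mul_self_of_norm_one hq₀, mul_one]
      rcases h3 with h3 | h3
      · rw [hq', h3, one_mul, hbq]
      · rw [hq', h3]
        simpa using hbq
  · obtain ⟨b, hb, hb1, hbI, -⟩ := exists_unit_orthogonal Quaternion.finrank_eq_four 1 unitI 0
    refine ⟨b, hb, by rw [← inner_one_left, hb1], fun u q hu hq hI hmem => ?_⟩
    rcases hI with hI | hI
    · rcases hQ q (hJ.mem_rightGroup hΨ hu hq hI hmem) with rfl | rfl
      · simpa using hbI
      · simpa using hbI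
    · exact absurd ⟨u, q, hu, hq, hI, hmem⟩ h0

omit Ψ hΨ hJ in
theorem IsHopf.exists_far_points (hE : Module.finrank ℝ E = 4) (hJ : IsHopf hS J) :
    ∃ x y : E, ‖x‖ = 1 ∧ ‖y‖ = 1 ∧
      ∀ g ∈ S, 2 * inner ℝ (g x) y ^ 2 ≤ 1 + √icosahedralConst := by
  obtain ⟨Ψ, hΨ⟩ := hJ.exists_quaternion_model hE
  have hκ := icosahedralConst_gt
  obtain ⟨a, b, ha, ha0, hb, hb0, hab⟩ : ∃ a b : ℍ[ℝ], ‖a‖ = 1 ∧ a.re = 0 ∧ ‖b‖ = 1 ∧ b.re = 0 ∧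
      ∀ u q : ℍ[ℝ], ‖u‖ = 1 → ‖q‖ = 1 →
        (star u * unitI * u = unitI ∨ star u * unitI * u = -unitI) → sandwich Ψ u q ∈ S →
          inner ℝ (star q * a * q) b ^ 2 ≤ icosahedralConst := by
    by_cases hQ : ∀ q ∈ rightGroup Ψ S, q = 1 ∨ q = -1
    · obtain ⟨b, hb, hb0, hab⟩ := hJ.exists_deep_hole_of_trivial hΨ hQ
      refine ⟨unitI, b, norm_unitI, rfl, hb, hb0, fun u q hu hq hI hmem => ?_⟩
      rw [hab u q hu hq hI hmem]
      linarith
    · push Not at hQ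
      obtain ⟨q₀, hq₀⟩ := hJ.exists_isMinimalRotation hΨ hQ
      obtain ⟨a, b, ha, ha0, hb, hb0, hab⟩ := hq₀.exists_deep_hole
      exact ⟨a, b, ha, ha0, hb, hb0, fun u q hu hq _ hmem =>
        hab q hq fun r hr => conj_mem_rightGroup hS hu hq hmem hr⟩
  obtain ⟨x, hx, rfl⟩ := exists_star_mul_unitI_mul ha ha0
  obtain ⟨y, hy, rfl⟩ := exists_star_mul_unitI_mul hb hb0
  refine ⟨Ψ x, Ψ y, by rw [Ψ.norm_map, hx], by rw [Ψ.norm_map, hy], fun g hg => ?_⟩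
  obtain ⟨u, q, hu, hq, hI, rfl⟩ := hJ.exists_eq_sandwich hΨ hg
  rw [sandwich_apply, Ψ.inner_map_map]
  have hle := two_mul_inner_sq_le (x := u * x * q) (y := y)
    (by rw [norm_mul, norm_mul, hu, hx, hq, one_mul, one_mul]) hy
  refine hle.trans (add_le_add_right ?_ 1)
  have hsq := Real.abs_le_sqrt (hab u q hu hq hI hg)
  -- The Hopf image of `u x q` is `±q̄ (x̄ i x) q`; the sign is why the deep hole must avoid axes
  -- rather than points.
  have e : star (u * x * q) * unitI * (u * x * q) =
      star q * (star x * (star u * unitI * u) * x) * q := by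
    rw [StarMul.star_mul, StarMul.star_mul]
    noncomm_ring
  rw [e]
  rcases hI with hI | hI
  · rw [hI]
    exact (abs_le.1 hsq).2
  · rw [hI]
    have e2 : star q * (star x * -unitI * x) * q = -(star q * (star x * unitI * x) * q) := by
      noncomm_ring
    rw [e2, inner_neg_left]
    linarith [(abs_le.1 hsq).1]

end Sandwich

/-! ### From orthogonal matrices to the diameter bound. -/

section Assembly

/-- Orthogonal matrices as operators on Euclidean four-space. -/
noncomputable def O4.toCLM : O4 →* (E4 →L[ℝ] E4) :=
  (Matrix.toEuclideanCLM (n := Fin 4) (𝕜 := ℝ) : Matrix (Fin 4) (Fin 4) ℝ →* _).comp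
    (Matrix.orthogonalGroup (Fin 4) ℝ).subtype

theorem O4.isClosedMap_toCLM : IsClosedMap O4.toCLM := by
  have h1 : IsClosedMap (Subtype.val : O4 → Matrix (Fin 4) (Fin 4) ℝ) := by
    refine IsClosed.isClosedMap_subtype_val ?_
    have : ((Matrix.orthogonalGroup (Fin 4) ℝ : Submonoid _) : Set (Matrix (Fin 4) (Fin 4) ℝ)) =
        {A | A * A.transpose = 1} := by
      ext A
      exact Matrix.mem_orthogonalGroup_iff (Fin 4) ℝ
    rw [this]
    exact isClosed_eq (by fun_prop) continuous_const
  have h2 : IsClosedMap (Matrix.toEuclideanCLM (n := Fin 4) (𝕜 := ℝ)) :=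
    ((Matrix.toEuclideanCLM (n := Fin 4) (𝕜 := ℝ)).toAlgEquiv.toLinearEquiv
      |>.toContinuousLinearEquiv).toHomeomorph.isClosedMap
  exact h2.comp h1

/-- The operators of a group of orthogonal matrices. -/
noncomputable def operatorGroup (G : Subgroup O4) : Submonoid (E4 →L[ℝ] E4) :=
  G.toSubmonoid.map O4.toCLM

theorem isClosedOrthogonal_operatorGroup {G : Subgroup O4} (hG : IsClosed (G : Set O4)) :
    IsClosedOrthogonal (operatorGroup G) where
  isClosed := O4.isClosedMap_toCLM _ hG
  norm_apply := by
    rintro _ ⟨A, -, rfl⟩ x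
    exact O4.norm_mulVec A x
  exists_inv := by
    rintro _ ⟨A, hA, rfl⟩
    refine ⟨O4.toCLM A⁻¹, ⟨A⁻¹, G.inv_mem hA, rfl⟩, ?_, ?_⟩
    · rw [← map_mul, inv_mul_cancel, map_one]
    · rw [← map_mul, mul_inv_cancel, map_one]

theorem le_orbitDiam {G : Subgroup O4} {r : ℝ} (hr0 : 0 ≤ r) (hr : r ≤ π) (x y : S3)
    (h : ∀ g ∈ G, inner ℝ ((g • x : S3) : E4) (y : E4) ≤ Real.cos r) : r ≤ orbitDiam G := by
  refine le_trans ?_ (le_csSup (bddAbove_orbitDist G) ⟨(Quotient.mk _ x, Quotient.mk _ y), rfl⟩)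
  obtain ⟨x₀, hx₀⟩ := MulAction.orbitRel.Quotient.nonempty_orbit
    (Quotient.mk (MulAction.orbitRel G S3) x)
  obtain ⟨y₀, hy₀⟩ := MulAction.orbitRel.Quotient.nonempty_orbit
    (Quotient.mk (MulAction.orbitRel G S3) y)
  refine le_csInf ⟨_, x₀, hx₀, y₀, hy₀, rfl⟩ ?_
  rintro _ ⟨x', hx', y', hy', rfl⟩
  obtain ⟨⟨g, hg⟩, rfl⟩ := MulAction.orbitRel.Quotient.mem_orbit.1 hx' |> Quotient.exact
  obtain ⟨⟨k, hk⟩, rfl⟩ := MulAction.orbitRel.Quotient.mem_orbit.1 hy' |> Quotient.exact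
  change r ≤ InnerProductGeometry.angle ((g • x : S3) : E4) ((k • y : S3) : E4)
  have hnorm : ∀ z : S3, ‖(z : E4)‖ = 1 := fun z => mem_sphere_zero_iff_norm.1 z.2
  rw [InnerProductGeometry.angle, hnorm, hnorm, one_mul, div_one, ← Real.arccos_cos hr0 hr]
  refine Real.arccos_le_arccos ?_
  -- Applying the isometry `k⁻¹` leaves only one moving point.
  have hk' : inner ℝ ((g • x : S3) : E4) ((k • y : S3) : E4) =
      inner ℝ (((k⁻¹ * g) • x : S3) : E4) (y : E4) := by
    have hS := isClosedOrthogonal_operatorGroup (G := ⊤) isClosed_univ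
    have e : ∀ z : S3, ((k • z : S3) : E4) = O4.toCLM k z := fun z => rfl
    have e2 : (g • x : S3) = k • ((k⁻¹ * g) • x : S3) := by rw [smul_smul, mul_inv_cancel_left]
    rw [e2, e, e, hS.inner_apply ⟨k, trivial, rfl⟩]
  rw [hk']
  exact h _ (G.mul_mem (G.inv_mem hk) hg)

theorem tan_three_pi_div_ten_div_sqrt_three :
    Real.tan (3 * π / 10) / √3 = √icosahedralConst := by
  have h5 : √5 ^ 2 = 5 := Real.sq_sqrt (by norm_num)
  have h5' : (2 : ℝ) < √5 := Real.lt_sqrt_of_sq_lt (by norm_num)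
  have h5'' : √5 < (3 : ℝ) := (Real.sqrt_lt' (by norm_num)).2 (by norm_num)
  have hangle : 3 * π / 10 = π / 2 - π / 5 := by ring
  have hpi := Real.pi_pos
  have hpos : 0 ≤ Real.tan (3 * π / 10) :=
    Real.tan_nonneg_of_nonneg_of_le_pi_div_two (by positivity) (by linarith)
  have hsin : Real.sin (π / 5) ^ 2 = (5 - √5) / 8 := by
    rw [Real.sin_sq, Real.cos_pi_div_five]
    linear_combination (-1 / 16) * h5
  have hsq : (Real.tan (3 * π / 10) / √3) ^ 2 = icosahedralConst := by
    rw [div_pow, Real.sq_sqrt (by norm_num), Real.tan_eq_sin_div_cos, hangle,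
      Real.sin_pi_div_two_sub, Real.cos_pi_div_two_sub, div_pow, hsin, Real.cos_pi_div_five,
      icosahedralConst]
    have : 5 - √5 ≠ 0 := by linarith
    field_simp
    linear_combination 216 * h5
  rw [← hsq, Real.sqrt_sq (by positivity)]

end Assembly

theorem mainTheorem5 (G : Subgroup O4) (hG : IsClosed (G : Set O4))
    (hcohom : ActsByCohomogeneity G 2) :
    Real.arccos (Real.tan (3 * π / 10) / √3) / 2 ≤ orbitDiam G := by
  rw [tan_three_pi_div_ten_div_sqrt_three]
  have hκ1 : √icosahedralConst ≤ 1 := by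
    rw [Real.sqrt_le_one]
    have h5'' : √5 < (3 : ℝ) := (Real.sqrt_lt' (by norm_num)).2 (by norm_num)
    rw [icosahedralConst]
    linarith
  have hκ0 := Real.sqrt_nonneg icosahedralConst
  have hα0 := Real.arccos_nonneg (√icosahedralConst)
  have hαπ := Real.arccos_le_pi (√icosahedralConst)
  -- The half-angle formula matches the bound `2⟨g x, y⟩² ≤ 1 + √icosahedralConst` below.
  have hcos : Real.cos (Real.arccos (√icosahedralConst) / 2) =
      √((1 + √icosahedralConst) / 2) := by
    rw [Real.cos_half (by linarith) hαπ, Real.cos_arccos (by linarith) hκ1]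
  have hS := isClosedOrthogonal_operatorGroup hG
  suffices hfar : ∃ x y : E4, ‖x‖ = 1 ∧ ‖y‖ = 1 ∧
      ∀ g ∈ operatorGroup G, 2 * inner ℝ (g x) y ^ 2 ≤ 1 + √icosahedralConst by
    obtain ⟨x, y, hx, hy, h⟩ := hfar
    refine le_orbitDiam (by linarith) (by linarith) ⟨x, mem_sphere_zero_iff_norm.2 hx⟩
      ⟨y, mem_sphere_zero_iff_norm.2 hy⟩ fun g hg => ?_
    rw [hcos]
    refine Real.le_sqrt_of_sq_le ?_
    have := h (O4.toCLM g) ⟨g, hg, rfl⟩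
    change inner ℝ (O4.toCLM g x) y ^ 2 ≤ _
    linarith
  obtain ⟨x, hx, d, hd, hM⟩ := hcohom
  obtain rfl : d = 1 := by omega
  have horb : (fun y : S3 => (y : E4)) '' MulAction.orbit G x =
      {y | ∃ g ∈ operatorGroup G, y = g (x : E4)} := by
    ext y
    constructor
    · rintro ⟨_, ⟨⟨g, hg⟩, rfl⟩, rfl⟩
      exact ⟨O4.toCLM g, ⟨g, hg, rfl⟩, rfl⟩
    · rintro ⟨_, ⟨g, hg, rfl⟩, rfl⟩
      exact ⟨g • x, ⟨⟨g, hg⟩, rfl⟩, rfl⟩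
  rw [horb] at hM
  obtain ⟨X, hX, hX0, hgen⟩ := hS.exists_lie_generator hM fun y hy => by
    obtain ⟨⟨g, hg⟩, hst⟩ := hx ⟨y, mem_sphere_zero_iff_norm.2 hy⟩
    refine ⟨O4.toCLM g, ⟨g, hg, rfl⟩, ?_⟩
    rintro _ ⟨k, hk, rfl⟩ hkx
    have h1 : (⟨k, hk⟩ : G) ∈ MulAction.stabilizer G x := Subtype.ext hkx
    exact congrArg Subtype.val (hst h1)
  have hfin : Module.finrank ℝ E4 = 4 := finrank_euclideanSpace_fin
  rcases exists_orthogonal_or_isHopf hS hX hX0 hgen with ⟨u, v, hu, hv, huv⟩ | ⟨J, hJ⟩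
  · refine ⟨u, v, hu, hv, fun g hg => ?_⟩
    rw [huv g hg]
    linarith
  · exact hJ.exists_far_points hfin
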